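/- Let $M$ be a matroid on a finite set $E$ and $M'$ a matroid on a finite set $E'$. Write $P(M)\subset\mathbb{R}^E$ for the base polytope of $M$ (the convex hull of the indicator vectors of its bases). A weak map $\varphi\colon M\to M'$ is a bijection $\varphi\colon E\to E'$ such that $P(M')\subset\varphi(P(M))$, where $\varphi$ also denotes the induced isomorphism $\mathbb{R}^E\to\mathbb{R}^{E'}$. **Whitney spaces.** For a strictly increasing tuple $\mathbf{k}$ of natural numbers, indexed by a finite set of consecutive integers, let $\Phi_{\mathbf{k}}(M)$ be the $\mathbb{Q}$-vector space with basis the flags of flats $(F_i)_i$ of $M$, $F_i\subseteq F_j$ for $i\le j$, with $\operatorname{rk}F_i=k_i$ for all $i$. A weak map $\varphi\colon M\to M'$ induces the linear map $\Phi_{\mathbf{k}}(\varphi)\colon\Phi_{\mathbf{k}}(M)\to\Phi_{\mathbf{k}}(M')$ that sends a flag $(F_i)_i$ to the flag $(\overline{\varphi(F_i)})_i$ of closures in $M'$ if $\operatorname{rk}_{M'}\varphi(F_i)=k_i$ for all $i$, and to $0$ otherwise. **Chow functors.** For $k\ge1$ let $Q_k$ be the graded $\mathbb{Q}$-vector space that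 is one-dimensional in each degree $i$ with $0<i<k$ and zero in all other degrees, and let $V(-n)$ denote $V$ shifted up by $n$ degrees. If $M$ has no loops, put $$\underline{\mathrm{CH}}(M)=\bigoplus_{r\ge0}\ \bigoplus_{0<k_1<\cdots<k_r}\Phi_{(k_1,\dots,k_r)}(M)\otimes Q_{k_1}\otimes Q_{k_2-k_1}\otimes\cdots\otimes Q_{k_r-k_{r-1}},$$ and put $\underline{\mathrm{CH}}(M)=0$ if $M$ has a loop. For every $M$ put $$\mathrm{CH}(M)=\bigoplus_{r\ge0}\ \bigoplus_{0\le k_0<k_1<\cdots<k_r}\Phi_{(k_0,\dots,k_r)}(M)\otimes \bigl(Q_{k_1-k_0}\otimes\cdots\otimes Q_{k_r-k_{r-1}}\bigr)(-k_0).$$ A weak map $\varphi\colon M\to M'$ induces graded linear maps $\underline{\mathrm{CH}}(\varphi)\colon\underline{\mathrm{CH}}(M)\to\underline{\mathrm{CH}}(M')$ and $\mathrm{CH}(\varphi)\colon\mathrm{CH}(M)\to\mathrm{CH}(M')$, given by the maps $\Phi_{\mathbf{k}}(\varphi)$ tensored with identities (the first map is $0$ if $M'$ has a loop; if $M'$ has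 no loops, neither has $M$). **Chow polynomials.** The augmented Chow ring of $M$ is the quotient of $\mathbb{Q}[x_F,y_e\mid F\text{ a flat of }M,\ e\in E]$ by the ideal generated by $\sum_F x_F$, by $y_e-\sum_{F\not\ni e}x_F$ for $e\in E$, by $y_ex_F$ for $e\notin F$, and by $x_Fx_G$ for incomparable flats $F,G$. The Chow ring of $M$ is the quotient of the augmented Chow ring by the ideal generated by all $y_e$ if $M$ has no loops, and is $0$ if $M$ has a loop. Both are graded with all $x_F$ and $y_e$ in degree $1$. Let $\underline{H}_M(t)$ and $H_M(t)$ be the Hilbert series $\sum_i t^i\dim_{\mathbb{Q}}(\,\cdot\,)_i$ of the Chow ring and of the augmented Chow ring, respectively. **Statement.** For any weak map $\varphi\colon M\to M'$, the maps $\underline{\mathrm{CH}}(\varphi)\colon\underline{\mathrm{CH}}(M)\to\underline{\mathrm{CH}}(M')$ and $\mathrm{CH}(\varphi)\colon\mathrm{CH}(M)\to\mathrm{CH}(M')$ are both surjective (in every degree). Moreover $\underline{H}_M(t)$, $\underline{H}_{M'}(t)$, $H_M(t)$ and $H_{M'}(t)$ are polynomials, and the polynomials $$\underline{H}_M(t)-\underline{H}_{M'}(t)\qquad\text{and}\qquad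 H_M(t)-H_{M'}(t)$$ have non-negative coefficients. -/

import Mathlib

open scoped TensorProduct DirectSum

namespace MatroidChow

universe u v

noncomputable section

/-! ### Weak maps -/

/-- The base polytope of a matroid on `E`: the convex hull in `ℝ^E` of the indicator vectors of
the bases. -/
def basePolytope {E : Type u} (M : Matroid E) : Set (E → ℝ) :=
  convexHull ℝ {p | ∃ B : Set E, M.IsBase B ∧ p = B.indicator 1}

/-- A bijection `φ : E ≃ E'` is a weak map `(E, M) → (E', M')` if `P(M') ⊆ φ(P(M))`, where `φ` acts
by the linear isomorphism `ℝ^E ≃ ℝ^E'` sending the basis vector of `e` to the one of `φ e`. -/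
def IsWeakMap {E : Type u} {E' : Type v} (φ : E ≃ E') (M : Matroid E) (M' : Matroid E') : Prop :=
  basePolytope M' ⊆ LinearEquiv.funCongrLeft ℝ ℝ φ.symm '' basePolytope M

/-! ### Chow rings and Chow polynomials -/

/-- The flats of `M`. -/
abbrev Flat {E : Type u} (M : Matroid E) : Type u := {F : Set E // M.IsFlat F}

/-- The polynomial ring `ℚ[x_F | F a flat] ⊗ ℚ[y_e | e ∈ E]`. -/
abbrev PolyRing {E : Type u} (M : Matroid E) : Type u := MvPolynomial (Flat M ⊕ E) ℚ

/-- The variable `x_F`. -/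
def x {E : Type u} {M : Matroid E} (F : Flat M) : PolyRing M := MvPolynomial.X (Sum.inl F)

/-- The variable `y_e`. -/
def y {E : Type u} (M : Matroid E) (e : E) : PolyRing M := MvPolynomial.X (Sum.inr e)

/-- The ideal of relations of the augmented Chow ring. -/
def augChowIdeal {E : Type u} (M : Matroid E) : Ideal (PolyRing M) :=
  Ideal.span {∑ᶠ F : Flat M, x F}
    ⊔ Ideal.span {p | ∃ e : E, p = y M e - ∑ᶠ (F : Flat M) (_ : e ∉ F.1), x F}
    ⊔ Ideal.span {p | ∃ (e : E) (F : Flat M), e ∉ F.1 ∧ p = y M e * x F}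
    ⊔ Ideal.span {p | ∃ F G : Flat M, ¬ F.1 ⊆ G.1 ∧ ¬ G.1 ⊆ F.1 ∧ p = x F * x G}

/-- The augmented Chow ring of `M`. -/
abbrev AugChowRing {E : Type u} (M : Matroid E) : Type u := PolyRing M ⧸ augChowIdeal M

open Classical in
/-- The ideal of the augmented Chow ring generated by all `y_e` if `M` has no loops, and the whole
ring if `M` has a loop. -/
def chowIdeal {E : Type u} (M : Matroid E) : Ideal (AugChowRing M) :=
  if M.Loopless then
    Ideal.span (Set.range fun e : E => Ideal.Quotient.mk (augChowIdeal M) (y M e))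
  else ⊤

/-- The Chow ring of `M`: the quotient of the augmented Chow ring by all `y_e` if `M` has no loops,
and the zero ring otherwise. -/
abbrev ChowRing {E : Type u} (M : Matroid E) : Type u := AugChowRing M ⧸ chowIdeal M

/-- The degree `d` part of the augmented Chow ring (every `x_F` and every `y_e` has degree `1`). -/
def augChowRingPiece {E : Type u} (M : Matroid E) (d : ℕ) : Submodule ℚ (AugChowRing M) :=
  (MvPolynomial.homogeneousSubmodule (Flat M ⊕ E) ℚ d).map
    (Ideal.Quotient.mkₐ ℚ (augChowIdeal M)).toLinearMap

/-- The degree `d` part of the Chow ring. -/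
def chowRingPiece {E : Type u} (M : Matroid E) (d : ℕ) : Submodule ℚ (ChowRing M) :=
  (augChowRingPiece M d).map (Ideal.Quotient.mkₐ ℚ (chowIdeal M)).toLinearMap

/-- The generating function of the dimensions of the graded pieces of the augmented Chow ring. -/
def augChowSeries {E : Type u} (M : Matroid E) : PowerSeries ℤ :=
  PowerSeries.mk fun d => (Module.finrank ℚ (augChowRingPiece M d) : ℤ)

/-- The generating function of the dimensions of the graded pieces of the Chow ring. -/
def chowSeries {E : Type u} (M : Matroid E) : PowerSeries ℤ :=
  PowerSeries.mk fun d => (Module.finrank ℚ (chowRingPiece M d) : ℤ)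

/-! ### Whitney spaces and the maps between them -/

/-- Flags `F_1 ⊆ ⋯ ⊆ F_r` of flats of `M` with `rk F_i = k_i`. -/
def Flag {E : Type u} (M : Matroid E) {r : ℕ} (k : Fin r → ℕ) : Type u :=
  {F : Fin r → Set E // (∀ i, M.IsFlat (F i) ∧ M.eRk (F i) = (k i : ℕ∞)) ∧ Monotone F}

/-- The vector space with basis the flags of flats of ranks `k`. -/
abbrev Whitney {E : Type u} (M : Matroid E) {r : ℕ} (k : Fin r → ℕ) : Type u := Flag M k →₀ ℚ

/-- The flag of the closures in `M'` of the images of the members of a flag of `M`, when these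
images still have the ranks `k`. -/
def Flag.push {E : Type u} {E' : Type v} {M : Matroid E} (φ : E ≃ E') (M' : Matroid E')
    {r : ℕ} {k : Fin r → ℕ} (F : Flag M k) (h : ∀ i, M'.eRk (φ '' F.1 i) = (k i : ℕ∞)) :
    Flag M' k :=
  ⟨fun i => M'.closure (φ '' F.1 i),
    fun i => ⟨M'.isFlat_closure _, by rw [Matroid.eRk_closure_eq, h i]⟩,
    fun _ _ hij => M'.closure_subset_closure (Set.image_mono (F.2.2 hij))⟩

open Classical in
/-- The linear map `Φ_k(φ)`: it sends a flag `F` to the flag of the closures of the `φ(F_i)` if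
`rk_{M'} φ(F_i) = k_i` for all `i`, and to `0` otherwise. -/
def whitneyMap {E : Type u} {E' : Type v} (φ : E ≃ E') (M : Matroid E) (M' : Matroid E')
    {r : ℕ} (k : Fin r → ℕ) : Whitney M k →ₗ[ℚ] Whitney M' k :=
  Finsupp.linearCombination ℚ fun F : Flag M k =>
    if h : ∀ i, M'.eRk (φ '' F.1 i) = (k i : ℕ∞) then Finsupp.single (F.push φ M' h) (1 : ℚ) else 0

/-! ### The Chow functors -/

/-- The degree `i` part of the graded vector space `Q_k`: one-dimensional for `0 < i < k`, and zero
for all other `i`. -/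
abbrev QPiece (k i : ℕ) : Type := PLift (0 < i ∧ i < k) →₀ ℚ

/-- The degree `d` part of the graded tensor product
`(Q_{k_1 - k_0} ⊗ Q_{k_2 - k_1} ⊗ ⋯ ⊗ Q_{k_r - k_{r-1}})(-n)`, where `k = (k_0, …, k_r)`. -/
abbrev QTensor {r : ℕ} (k : Fin (r + 1) → ℕ) (n d : ℕ) : Type :=
  ⨁ m : {m : Fin r → ℕ // n + ∑ i, m i = d},
    ⨂[ℚ] i : Fin r, QPiece (k i.succ - k i.castSucc) (m.1 i)

/-- Tuples `k = (k_1, …, k_r)` of any length `r ≥ 0` with `0 < k_1 < ⋯ < k_r`. -/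
abbrev PosTuple : Type := Σ r : ℕ, {k : Fin r → ℕ // StrictMono k ∧ ∀ i, 0 < k i}

/-- Tuples `k = (k_0, …, k_r)` with `r ≥ 0` and `k_0 < k_1 < ⋯ < k_r`. -/
abbrev AugTuple : Type := Σ r : ℕ, {k : Fin (r + 1) → ℕ // StrictMono k}

/-- The degree `d` part of
`⨁_k Φ_k(M) ⊗ Q_{k_1} ⊗ Q_{k_2 - k_1} ⊗ ⋯ ⊗ Q_{k_r - k_{r-1}}`, over `0 < k_1 < ⋯ < k_r`. -/
abbrev ChowSumPiece {E : Type u} (M : Matroid E) (d : ℕ) : Type u :=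
  ⨁ k : PosTuple, Whitney M k.2.1 ⊗[ℚ] QTensor (Fin.cons 0 k.2.1 : Fin (k.1 + 1) → ℕ) 0 d

/-- The map induced by the maps `Φ_k(φ)` on the spaces `ChowSumPiece`. -/
def chowSumMap {E : Type u} {E' : Type v} (φ : E ≃ E') (M : Matroid E) (M' : Matroid E') (d : ℕ) :
    ChowSumPiece M d →ₗ[ℚ] ChowSumPiece M' d :=
  DirectSum.lmap fun k : PosTuple =>
    (whitneyMap φ M M' k.2.1).rTensor (QTensor (Fin.cons 0 k.2.1 : Fin (k.1 + 1) → ℕ) 0 d)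

/-- The degree `d` part of the Chow functor on objects: `ChowSumPiece M d` if `M` has no loops, and
zero otherwise (functions on an empty type). -/
abbrev ChowPiece {E : Type u} (M : Matroid E) (d : ℕ) : Type u :=
  PLift M.Loopless → ChowSumPiece M d

open Classical in
/-- The degree `d` part of the Chow functor on a morphism `φ`: `chowSumMap` if neither matroid has
loops, and zero otherwise. -/
def chowMap {E : Type u} {E' : Type v} (φ : E ≃ E') (M : Matroid E) (M' : Matroid E') (d : ℕ) :
    ChowPiece M d →ₗ[ℚ] ChowPiece M' d :=
  LinearMap.pi fun _ =>
    if h : M.Loopless then chowSumMap φ M M' d ∘ₗ LinearMap.proj (PLift.up h) else 0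

/-- The degree `d` part of the augmented Chow functor on objects:
`⨁_k Φ_k(M) ⊗ (Q_{k_1 - k_0} ⊗ ⋯ ⊗ Q_{k_r - k_{r-1}})(-k_0)`, over `k_0 < k_1 < ⋯ < k_r`. -/
abbrev AugChowPiece {E : Type u} (M : Matroid E) (d : ℕ) : Type u :=
  ⨁ k : AugTuple, Whitney M k.2.1 ⊗[ℚ] QTensor k.2.1 (k.2.1 0) d

/-- The degree `d` part of the augmented Chow functor on a morphism `φ`. -/
def augChowMap {E : Type u} {E' : Type v} (φ : E ≃ E') (M : Matroid E) (M' : Matroid E') (d : ℕ) :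
    AugChowPiece M d →ₗ[ℚ] AugChowPiece M' d :=
  DirectSum.lmap fun k : AugTuple =>
    (whitneyMap φ M M' k.2.1).rTensor (QTensor k.2.1 (k.2.1 0) d)

end

end MatroidChow

/-! Inclusion of base polytopes says that bases of `M'` pull back along `φ` to bases of `M`, because
an indicator vector in a base polytope belongs to a base. Hence independent sets pull back and ranks
can only drop along `φ`. Given a chain of flats of `M'`, choose one independent set `I` of `M'`
containing a basis of each member and lift `F` to the closure in `M` of `φ⁻¹(I ∩ F)`. The lift is
order preserving, keeps ranks, and pushes forward to `F` again. So every basis flag is hit by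
`whitneyMap`; tensoring and direct sums preserve surjectivity.

The Hilbert series are compared through monomial bases. Write `h_H` for the sum of `x_G` over `G ≥
H`. Since `y_e = h_⊥ - h_a`, with `a` the closure of `e`, the variables `y_e` can be eliminated. The
remaining ideal is generated by `x_G x_H` for incomparable `G, H`, by `x_G h_H^(rk H - rk G)` for `G
< H`, and by `h_H^(b H)`, where `b H` is `rk H + 1` in the augmented case and `max 1 (rk H)` for the
Chow ring of a loopless matroid. Monomials supported on chains, with exponents below the rank jumps
and below `b`, span the quotient (`monomial_mem_span_standard`) and are independent
(`eq_zero_of_mem_relatorIdeal`).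

Standardness of an exponent depends only on its chain and the ranks in it, so the same lift injects
standard exponents of `M'` into those of `M` in each degree. If `M'` has a loop, its Chow ring is
zero; otherwise `M` is loopless too. -/

namespace MatroidChow

/-! ### Division by a monic polynomial -/

open Polynomial in
/-- If an element of degree less than `deg p` lies in the ideal `I + X J + (p)`, then it already
lies in `I + X J`. -/
theorem coeff_mem_of_mem_sup_span {S : Type*} [CommRing S] {I J : Ideal S}
    {p : S[X]} (hp : p.Monic) (h0 : ∀ j ∈ J, j * p.coeff 0 ∈ I) {f : S[X]}
    (hf : f ∈ (J.map (C : S →+* S[X]) ⊓ I.comap constantCoeff) ⊔ Ideal.span {p})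
    (hdeg : f.degree < p.degree) : f.coeff 0 ∈ I ∧ ∀ i, f.coeff i ∈ J := by
  obtain ⟨g, hg, q', hq', rfl⟩ := Submodule.mem_sup.1 hf
  obtain ⟨q, rfl⟩ := Ideal.mem_span_singleton'.1 hq'
  have hgJ := Ideal.mem_map_C_iff.1 hg.1
  have hgI : g.coeff 0 ∈ I := hg.2
  -- Modulo `J` the summand `g` dies, so a multiple of the monic `p` has degree below that of `p`;
  -- the quotient `q` must vanish modulo `J`.
  have key : ∀ i, q.coeff i ∈ J := by
    set π := Ideal.Quotient.mk J
    rcases subsingleton_or_nontrivial (S ⧸ J) with hs | hn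
    · intro i
      rw [← Ideal.Quotient.eq_zero_iff_mem]
      exact Subsingleton.elim _ _
    have hg0 : g.map π = 0 := by
      ext i
      simpa [π, Ideal.Quotient.eq_zero_iff_mem] using hgJ i
    have hpm : (p.map π).Monic := hp.map π
    have hd : (q.map π * p.map π).degree < (p.map π).degree := by
      have h1 : (g + q * p).map π = q.map π * p.map π := by
        simp [hg0]
      rw [← h1, hp.degree_map π]
      exact lt_of_le_of_lt (degree_map_le) hdeg
    have hz : q.map π * p.map π = 0 := by
      by_contra hne
      exact hpm.not_dvd_of_degree_lt hne hd (dvd_mul_left _ _)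
    have hq0 : q.map π = 0 := by
      by_contra hne
      rw [hpm.degree_mul] at hd
      rw [degree_eq_natDegree hne, degree_eq_natDegree hpm.ne_zero] at hd
      have : q.map π * p.map π ≠ 0 := fun h => hne (by simpa using (hpm.mul_left_eq_zero_iff).1 h)
      exact this hz
    intro i
    have := congrArg (fun t => t.coeff i) hq0
    simpa [π, Ideal.Quotient.eq_zero_iff_mem] using this
  constructor
  · rw [coeff_add, mul_coeff_zero]
    exact I.add_mem hgI (h0 _ (key 0))
  · intro i
    rw [coeff_add]
    refine J.add_mem (hgJ i) ?_
    rw [coeff_mul]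
    exact J.sum_mem fun x _ => J.mul_mem_right _ (key _)

/-! ### Polynomials as univariate polynomials in one chosen variable -/

section Isolate

open MvPolynomial

variable {L : Type*} {R : Type*} [CommRing R]

/-- Isolate the variable `F`. -/
noncomputable def isolate (R : Type*) [CommRing R] (F : L) :
    MvPolynomial L R →ₐ[R] Polynomial (MvPolynomial L R) :=
  open Classical in
  aeval fun G => if G = F then Polynomial.X else Polynomial.C (X G)

theorem isolate_X_self (F : L) : isolate R F (X F) = Polynomial.X := by
  simp [isolate]

theorem isolate_X_of_ne {F G : L} (h : G ≠ F) : isolate R F (X G) = Polynomial.C (X G) := by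
  simp [isolate, h]

theorem eval_isolate (F : L) (f : MvPolynomial L R) :
    Polynomial.eval (X F) (isolate R F f) = f := by
  induction f using MvPolynomial.induction_on with
  | C a =>
    have : isolate R F (C a) = Polynomial.C (C a) := by
      simp [isolate, IsScalarTower.algebraMap_apply R (MvPolynomial L R) (Polynomial _)]
    simp [this]
  | add p q hp hq => simp [hp, hq]
  | mul_X p G hp =>
    rw [map_mul, Polynomial.eval_mul, hp]
    by_cases h : G = F
    · subst h; simp [isolate_X_self]
    · simp [isolate_X_of_ne h]

theorem isolate_monomial (F : L) (m : L →₀ ℕ) (c : R) :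
    isolate R F (monomial m c) =
      Polynomial.C (monomial (m.erase F) c) * Polynomial.X ^ m F := by
  classical
  have hC : ∀ f : MvPolynomial L R, (∀ n ∈ f.support, n F = 0) →
      isolate R F f = Polynomial.C f := by
    intro f hf
    have h1 : isolate R F f = aeval (fun G => (Polynomial.C (X G) :
        Polynomial (MvPolynomial L R))) f := by
      rw [isolate]
      refine eval₂Hom_congr' rfl ?_ rfl
      intro G hG _
      rw [mem_vars_iff_mem_support] at hG
      obtain ⟨n, hn, hGn⟩ := hG
      rw [if_neg]
      rintro rfl
      exact (Finsupp.mem_support_iff.1 hGn) (hf n hn)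
    rw [h1]
    have h2 : (aeval (fun G => (Polynomial.C (X G) : Polynomial (MvPolynomial L R)))) =
        (IsScalarTower.toAlgHom R (MvPolynomial L R) (Polynomial (MvPolynomial L R))) := by
      ext G
      simp
    rw [h2]
    rfl
  have hm : monomial m c = monomial (m.erase F) c * X F ^ m F := by
    rw [X_pow_eq_monomial, monomial_mul, mul_one, Finsupp.erase_add_single]
  rw [hm, map_mul, map_pow, isolate_X_self, hC]
  intro n hn
  have : n = m.erase F := by
    have := support_monomial_subset hn
    simpa using this
  simp [this]

/-- This lets standardness pass from the monomials of `f` to those of its coefficients with respect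
to `x_F`. -/
theorem coeff_isolate_support {F : L} {f : MvPolynomial L R} {i : ℕ} {n : L →₀ ℕ}
    (hn : n ∈ ((isolate R F f).coeff i).support) :
    ∃ m ∈ f.support, m F = i ∧ n = m.erase F := by
  classical
  have h : (isolate R F f).coeff i =
      ∑ m ∈ f.support, if m F = i then monomial (m.erase F) (f.coeff m) else 0 := by
    conv_lhs => rw [f.as_sum]
    rw [map_sum, Polynomial.finsetSum_coeff]
    refine Finset.sum_congr rfl fun m _ => ?_
    rw [isolate_monomial, Polynomial.coeff_C_mul_X_pow]
    simp [eq_comm]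
  rw [h] at hn
  obtain ⟨m, hm, hnm⟩ := Finset.mem_biUnion.1 (support_sum hn)
  split_ifs at hnm with hi
  · exact ⟨m, hm, hi, by simpa using support_monomial_subset hnm⟩
  · simp at hnm

end Isolate

/-! ### Linear independence of the standard monomials -/

section Independence

open MvPolynomial

variable {L : Type*} [SemilatticeSup L] [Fintype L] {R : Type*} [CommRing R]

open Classical in
/-- The sum of the variables of all elements above `H`. -/
noncomputable def upperSum (R : Type*) [CommRing R] (H : L) : MvPolynomial L R :=
  ∑ G with H ≤ G, X G

/-- The straightening relations attached to a rank function `r`, a bound `b` and a set `P` of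
allowed elements. -/
inductive Relator (R : Type*) [CommRing R] (r b : L → ℕ) (P : Set L) : MvPolynomial L R → Prop
  | var {G : L} : G ∉ P → Relator R r b P (X G)
  | incomp {G H : L} : ¬ G ≤ H → ¬ H ≤ G → Relator R r b P (X G * X H)
  | pair {G H : L} : G < H → Relator R r b P (X G * upperSum R H ^ (r H - r G))
  | pow {H : L} : H ∈ P → Relator R r b P (upperSum R H ^ b H)

/-- The ideal generated by the straightening relations. -/
noncomputable def relatorIdeal (R : Type*) [CommRing R] (r b : L → ℕ) (P : Set L) : Ideal (MvPolynomial L R) :=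
  Ideal.span {p | Relator R r b P p}

/-- The standard exponents: supported on a chain in `P`, and bounded by the rank jumps. -/
structure IsStandard (r b : L → ℕ) (P : Set L) (m : L →₀ ℕ) : Prop where
  mem : ∀ H, m H ≠ 0 → H ∈ P
  chain : ∀ G H, m G ≠ 0 → m H ≠ 0 → G ≤ H ∨ H ≤ G
  lt : ∀ H, m H ≠ 0 → m H < b H
  lt_sub : ∀ G H, G < H → m G ≠ 0 → m H ≠ 0 → m H < r H - r G

/-- The conditions on the bound `b` under which the standard monomials are independent. -/
structure IsBound (r b : L → ℕ) (P : Set L) : Prop where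
  pos : ∀ F ∈ P, 0 < b F
  sup_le : ∀ F ∈ P, ∀ G ∈ P, ¬ F ≤ G → r (G ⊔ F) ≤ b F + r G
  le_add : ∀ F ∈ P, ∀ H ∈ P, F < H → b H + r F ≤ b F + r H

/-- The two sums differ by variables `x_H` with `F ≤ H` and not `G ⊔ F ≤ H`. Such `H` is
incomparable with `G`: `G ≤ H` would give `G ⊔ F ≤ H`, and `H ≤ G` would give `F ≤ G`. -/
theorem upperSum_sub_mem {K : Ideal (MvPolynomial L R)}
    (hK : ∀ G H : L, ¬ G ≤ H → ¬ H ≤ G → (X G * X H : MvPolynomial L R) ∈ K) {F G : L}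
    (h : ¬ F ≤ G) : X G * upperSum R F - X G * upperSum R (G ⊔ F) ∈ K := by
  classical
  have hsub : (Finset.univ.filter fun K : L => G ⊔ F ≤ K) ⊆ Finset.univ.filter fun K => F ≤ K := by
    intro K hK
    simp only [Finset.mem_filter, Finset.mem_univ, true_and] at hK ⊢
    exact le_sup_right.trans hK
  rw [← mul_sub, upperSum, upperSum, ← Finset.sum_sdiff hsub, add_sub_cancel_right, Finset.mul_sum]
  refine K.sum_mem fun H hH => hK _ _ ?_ ?_
  · intro hGH
    simp only [Finset.mem_sdiff, Finset.mem_filter, Finset.mem_univ, true_and] at hH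
    exact hH.2 (sup_le hGH hH.1)
  · intro hHG
    simp only [Finset.mem_sdiff, Finset.mem_filter, Finset.mem_univ, true_and] at hH
    exact h (hH.1.trans hHG)

theorem mul_pow_sub_mem {S : Type*} [CommRing S] {K : Ideal S} {x a b : S}
    (h : x * a - x * b ∈ K) (n : ℕ) : x * a ^ n - x * b ^ n ∈ K := by
  have : x * a ^ n - x * b ^ n = x * (a ^ n - b ^ n) := by ring
  obtain ⟨c, hc⟩ := sub_dvd_pow_sub_pow a b n
  rw [this, hc, ← mul_assoc, mul_sub]
  exact K.mul_mem_right _ h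

theorem mul_pow_mem_of_le {S : Type*} [CommRing S] {K : Ideal S} {x a : S} {m n : ℕ}
    (hmn : m ≤ n) (h : x * a ^ m ∈ K) : x * a ^ n ∈ K := by
  obtain ⟨k, rfl⟩ := Nat.exists_eq_add_of_le hmn
  rw [pow_add, ← mul_assoc]
  exact K.mul_mem_right _ h

/-- `x_G h_F^n` is a multiple of a straightening relation as soon as `n ≥ r (G ⊔ F) - r G`. -/
theorem X_mul_upperSum_pow_mem {r : L → ℕ} {K : Ideal (MvPolynomial L R)}
    (hK : ∀ G H : L, ¬ G ≤ H → ¬ H ≤ G → (X G * X H : MvPolynomial L R) ∈ K)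
    (hK' : ∀ G H : L, G < H → (X G * upperSum R H ^ (r H - r G) : MvPolynomial L R) ∈ K)
    {F G : L} (h : ¬ F ≤ G) {n : ℕ} (hn : r (G ⊔ F) ≤ n + r G) :
    X G * upperSum R F ^ n ∈ K := by
  have h1 := mul_pow_sub_mem (upperSum_sub_mem hK h) n
  have h2 : X G * upperSum R (G ⊔ F) ^ n ∈ K :=
    mul_pow_mem_of_le (by omega) (hK' G (G ⊔ F) (left_lt_sup.2 h))
  simpa using K.add_mem h1 h2

theorem isolate_upperSum_of_not_le {F H : L} (h : ¬ H ≤ F) :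
    isolate R F (upperSum R H) = Polynomial.C (upperSum R H) := by
  classical
  rw [upperSum, map_sum, map_sum]
  refine Finset.sum_congr rfl fun G hG => isolate_X_of_ne ?_
  rintro rfl
  exact h (by simpa using hG)

open Classical in
/-- The sum of the variables of all elements strictly above `F`. -/
noncomputable def strictUpperSum (R : Type*) [CommRing R] (F : L) : MvPolynomial L R :=
  ∑ G with F < G, X G

theorem upperSum_eq (F : L) : upperSum R F = X F + strictUpperSum R F := by
  classical
  rw [upperSum, strictUpperSum, ← Finset.sum_insert (f := fun G => (X G : MvPolynomial L R))
    (by simp)]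
  refine Finset.sum_congr ?_ fun _ _ => rfl
  ext G
  simp [le_iff_eq_or_lt, eq_comm]

theorem isolate_upperSum_self (F : L) :
    isolate R F (upperSum R F) = Polynomial.X + Polynomial.C (strictUpperSum R F) := by
  classical
  rw [upperSum_eq, map_add, isolate_X_self]
  congr 1
  rw [strictUpperSum, map_sum, map_sum]
  refine Finset.sum_congr rfl fun G hG => isolate_X_of_ne ?_
  rintro rfl
  simp at hG

/-- Induction on `P`, viewing `f` as a polynomial in `x_F` for a minimal `F ∈ P`. The constant
coefficient is governed by `P` without `F` and the same `b`; the higher ones, whose monomials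
contain `x_F`, by the elements above `F` with the new bound `r H - r F`. The relation `h_F^(b F)` is
monic in `x_F` of degree `b F`, which exceeds the degree of `f` in `x_F`, so it can be divided out.
-/
theorem eq_zero_of_mem_relatorIdeal {r : L → ℕ} (hr : StrictMono r)
    (hsub : ∀ B F G : L, B ≤ F → B ≤ G → r (G ⊔ F) + r B ≤ r F + r G) (P : Finset L)
    (hP : IsUpperSet (P : Set L)) {b : L → ℕ} (hb : IsBound r b P) {f : MvPolynomial L R}
    (hf : f ∈ relatorIdeal R r b P) (hstd : ∀ m ∈ f.support, IsStandard r b P m) : f = 0 := by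
  classical
  rcases subsingleton_or_nontrivial R with _ | _
  · exact Subsingleton.elim _ _
  induction hn : P.card using Nat.strong_induction_on generalizing P b f with
  | _ n ih =>
  rcases P.eq_empty_or_nonempty with rfl | hne
  · have h0 : f = C (constantCoeff f) := by
      ext m
      by_cases hm : m ∈ f.support
      · have : m = 0 := by
          ext H
          by_contra hH
          simpa using (hstd m hm).mem H hH
        subst this
        simp [constantCoeff]
      · rw [notMem_support_iff.1 hm, coeff_C]
        split_ifs with h
        · subst h
          simpa [constantCoeff] using (notMem_support_iff.1 hm).symm
        · rfl
    have h1 : relatorIdeal R r b ((∅ : Finset L) : Set L) ≤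
        RingHom.ker (constantCoeff : MvPolynomial L R →+* R) := by
      rw [relatorIdeal, Ideal.span_le]
      intro p hp
      rcases hp with _ | _ | _ | hH
      · simp
      · simp
      · simp
      · simp at hH
    have h2 : constantCoeff f = 0 := h1 hf
    rw [h0, h2, map_zero]
  obtain ⟨F, hFP, hFmin⟩ := P.exists_minimal hne
  have hFmin' : ∀ G ∈ P, G ≤ F → G = F := fun G hG h => le_antisymm h (hFmin hG h)
  set P₀ := P.erase F with hP₀
  set U : Finset L := Finset.univ.filter fun G => F < G with hU
  have hmemU : ∀ G, G ∈ U ↔ F < G := by simp [hU]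
  have hUP : U ⊆ P₀ := fun G hG => by
    rw [hmemU] at hG
    exact Finset.mem_erase.2 ⟨hG.ne', hP hG.le hFP⟩
  have hcard : P₀.card < P.card := Finset.card_erase_lt_of_mem hFP
  have hP₀up : IsUpperSet (P₀ : Set L) := by
    intro G H hGH hG
    have hG' := Finset.mem_erase.1 hG
    refine Finset.mem_erase.2 ⟨?_, hP hGH hG'.2⟩
    rintro rfl
    exact hG'.1 (hFmin' G hG'.2 hGH)
  have hUup : IsUpperSet (U : Set L) := by
    intro G H hGH hG
    simp only [Finset.mem_coe, hmemU] at hG ⊢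
    exact hG.trans_le hGH
  have hb₀ : IsBound r b P₀ :=
    ⟨fun G hG => hb.pos G (Finset.mem_of_mem_erase hG),
      fun G hG H hH => hb.sup_le G (Finset.mem_of_mem_erase hG) H (Finset.mem_of_mem_erase hH),
      fun G hG H hH => hb.le_add G (Finset.mem_of_mem_erase hG) H (Finset.mem_of_mem_erase hH)⟩
  have hbU : IsBound r (fun H => r H - r F) U := by
    refine ⟨fun G hG => ?_, fun G hG H hH h => ?_, fun G hG H hH h => ?_⟩
    · have := hr ((hmemU G).1 hG)
      omega
    · have h1 := hr ((hmemU G).1 hG)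
      have h2 := hsub F G H ((hmemU G).1 hG).le ((hmemU H).1 hH).le
      omega
    · have h1 := hr ((hmemU G).1 hG)
      have h2 := hr ((hmemU H).1 hH)
      omega
  set I := relatorIdeal R r b (P₀ : Set L) with hI
  set J := relatorIdeal R r (fun H => r H - r F) (U : Set L) with hJ
  have memI : ∀ {p}, Relator R r b P₀ p → p ∈ I := fun h => Ideal.subset_span h
  have memJ : ∀ {p}, Relator R r (fun H => r H - r F) U p → p ∈ J :=
    fun h => Ideal.subset_span h
  -- Only the powers `h_H^(b H)` need work: modulo `J` the variables not above `F` vanish, so `h_H`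
  -- becomes `h_(F ⊔ H)`, and `IsBound.sup_le` makes `b H` a large enough exponent.
  have hIJ : I ≤ J := by
    rw [hI, relatorIdeal, Ideal.span_le]
    intro p hp
    rcases hp with hG | ⟨h1, h2⟩ | hGH | hH
    · exact memJ (.var fun h => hG (hUP h))
    · exact memJ (.incomp h1 h2)
    · exact memJ (.pair hGH)
    · rename_i H
      have hHP := Finset.mem_of_mem_erase hH
      have hHF : ¬ H ≤ F := fun h => (Finset.mem_erase.1 hH).1 (hFmin' H hHP h)
      have h1 : upperSum R H - upperSum R (F ⊔ H) ∈ J := by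
        have hs : (Finset.univ.filter fun K : L => F ⊔ H ≤ K) ⊆
            Finset.univ.filter fun K => H ≤ K := by
          intro K hK
          simp only [Finset.mem_filter, Finset.mem_univ, true_and] at hK ⊢
          exact le_sup_right.trans hK
        rw [upperSum, upperSum, ← Finset.sum_sdiff hs, add_sub_cancel_right]
        refine J.sum_mem fun K hK => memJ (.var ?_)
        simp only [Finset.mem_sdiff, Finset.mem_filter, Finset.mem_univ, true_and] at hK
        rw [Finset.mem_coe, hmemU]
        exact fun h => hK.2 (sup_le h.le hK.1)
      have h2 : (1 : MvPolynomial L R) * upperSum R (F ⊔ H) ^ b H ∈ J := by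
        refine mul_pow_mem_of_le (m := r (F ⊔ H) - r F) ?_ ?_
        · have := hb.sup_le H hHP F hFP hHF
          omega
        · rw [one_mul]
          refine memJ (.pow (H := F ⊔ H) ?_)
          rw [Finset.mem_coe, hmemU]
          exact left_lt_sup.2 hHF
      have h3 := mul_pow_sub_mem (K := J) (x := 1) (by simpa using h1) (b H)
      simpa using J.add_mem h3 h2
  set s := strictUpperSum R F with hs
  set p : Polynomial (MvPolynomial L R) := (Polynomial.X + Polynomial.C s) ^ b F with hp
  have hmonic : p.Monic := (Polynomial.monic_X_add_C s).pow _
  have hp0 : p.coeff 0 = s ^ b F := by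
    rw [Polynomial.coeff_zero_eq_eval_zero, hp]
    simp
  have hincI : ∀ G H : L, ¬ G ≤ H → ¬ H ≤ G → (X G * X H : MvPolynomial L R) ∈ I :=
    fun G H h1 h2 => memI (.incomp h1 h2)
  have hpairI : ∀ G H : L, G < H →
      (X G * upperSum R H ^ (r H - r G) : MvPolynomial L R) ∈ I := fun G H h => memI (.pair h)
  -- This compatibility is what allows division by `p`: multiplying a generator of `J` by `s ^ b F`
  -- must lead back into `I`.
  have hJI : ∀ j ∈ J, j * p.coeff 0 ∈ I := by
    rw [hp0]
    suffices h : J ≤ Submodule.comap (LinearMap.mulRight (MvPolynomial L R) (s ^ b F)) I from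
      fun j hj => h hj
    rw [hJ, relatorIdeal, Ideal.span, Submodule.span_le]
    intro q hq
    change q * s ^ b F ∈ I
    rcases hq with hG | ⟨h1, h2⟩ | hGH | hH
    · rename_i G
      rw [Finset.mem_coe, hmemU] at hG
      by_cases hGP : G ∈ P₀
      · have hGF : ¬ F ≤ G := fun h => hG (lt_of_le_of_ne h (Finset.mem_erase.1 hGP).1.symm)
        have h1 : X G * upperSum R F ^ b F ∈ I := by
          refine X_mul_upperSum_pow_mem hincI hpairI hGF ?_
          exact hb.sup_le F hFP G (Finset.mem_of_mem_erase hGP) hGF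
        -- Since `F ∉ P₀`, the variable `x_F` lies in `I`, so `h_F` and `s` agree modulo `I`.
        have h2 : X G * upperSum R F - X G * s ∈ I := by
          rw [upperSum_eq, ← mul_sub, add_sub_cancel_right, mul_comm]
          exact I.mul_mem_right _ (memI (.var (by simp [hP₀])))
        have h3 := mul_pow_sub_mem h2 (b F)
        simpa using I.sub_mem h1 h3
      · exact I.mul_mem_right _ (memI (.var hGP))
    · exact I.mul_mem_right _ (memI (.incomp h1 h2))
    · exact I.mul_mem_right _ (memI (.pair hGH))
    · rename_i H
      have hHF := (hmemU H).1 hH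
      set e := r H - r F with he
      -- The variables `x_G` in `s - h_H` have `F < G` and not `H ≤ G`; submodularity over `F` gives
      -- `r (G ⊔ H) - r G ≤ e`, so `h_H^e` kills each. Thus `s ^ b F` may be replaced by `h_H ^ b
      -- F`, and `e + b F ≥ b H` by `IsBound.le_add`.
      have h1 : upperSum R H ^ e * s - upperSum R H ^ e * upperSum R H ∈ I := by
        have hss : (Finset.univ.filter fun K : L => H ≤ K) ⊆
            Finset.univ.filter fun K => F < K := by
          intro K hK
          simp only [Finset.mem_filter, Finset.mem_univ, true_and] at hK ⊢
          exact hHF.trans_le hK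
        have hsum : s - upperSum R H = ∑ K ∈ (Finset.univ.filter fun K : L => F < K) \
            Finset.univ.filter fun K => H ≤ K, X K := by
          rw [hs, strictUpperSum, upperSum, ← Finset.sum_sdiff hss, add_sub_cancel_right]
        rw [← mul_sub, hsum, Finset.mul_sum]
        refine I.sum_mem fun G hG => ?_
        simp only [Finset.mem_sdiff, Finset.mem_filter, Finset.mem_univ, true_and] at hG
        rw [mul_comm]
        refine X_mul_upperSum_pow_mem hincI hpairI hG.2 ?_
        have h2 := hsub F H G hHF.le hG.1.le
        have h3 := hr hHF
        omega
      have h2 := mul_pow_sub_mem h1 (b F)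
      have h3 : upperSum R H ^ e * upperSum R H ^ b F ∈ I := by
        rw [← pow_add, ← one_mul (upperSum R H ^ _)]
        refine mul_pow_mem_of_le (m := b H) ?_ ?_
        · have h4 := hb.le_add F hFP H (Finset.mem_of_mem_erase (hUP hH)) hHF
          have h5 := hr hHF
          omega
        · rw [one_mul]
          exact memI (.pow (hUP hH))
      simpa using I.add_mem h2 h3
  -- As `I ≤ J`, this is `I + X J[X]`: coefficients in `J`, constant one in `I`.
  set T := J.map (Polynomial.C : MvPolynomial L R →+* Polynomial (MvPolynomial L R)) ⊓
    I.comap Polynomial.constantCoeff with hT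
  have hCI : ∀ q ∈ I, Polynomial.C q ∈ T := fun q hq =>
    ⟨Ideal.mem_map_of_mem _ (hIJ hq), by simpa using hq⟩
  have hXJ : ∀ q ∈ J, Polynomial.X * Polynomial.C q ∈ T := fun q hq =>
    ⟨Ideal.mul_mem_left _ _ (Ideal.mem_map_of_mem _ hq), by simp⟩
  have hmem : isolate R F f ∈ T ⊔ Ideal.span {p} := by
    suffices h : relatorIdeal R r b P ≤ (T ⊔ Ideal.span {p}).comap (isolate R F) from h hf
    rw [relatorIdeal, Ideal.span_le]
    intro q hq
    rw [SetLike.mem_coe, Ideal.mem_comap]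
    rcases hq with hG | ⟨h1, h2⟩ | hGH | hH
    · rename_i G
      refine Ideal.mem_sup_left ?_
      rw [isolate_X_of_ne (by rintro rfl; exact hG hFP)]
      exact hCI _ (memI (.var fun h => hG (Finset.mem_of_mem_erase h)))
    · rename_i G H
      refine Ideal.mem_sup_left ?_
      have hvar : ∀ K : L, ¬ F ≤ K → (X K : MvPolynomial L R) ∈ J := fun K hK =>
        memJ (.var (by rw [Finset.mem_coe, hmemU]; exact fun h => hK h.le))
      by_cases hGF : G = F
      · subst hGF
        rw [map_mul, isolate_X_self, isolate_X_of_ne (by rintro rfl; exact h1 le_rfl)]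
        exact hXJ _ (hvar _ h1)
      by_cases hHF : H = F
      · subst hHF
        rw [map_mul, isolate_X_self, isolate_X_of_ne hGF, mul_comm]
        exact hXJ _ (hvar _ h2)
      rw [map_mul, isolate_X_of_ne hGF, isolate_X_of_ne hHF, ← map_mul]
      exact hCI _ (memI (.incomp h1 h2))
    · rename_i G H
      refine Ideal.mem_sup_left ?_
      by_cases hHF : H ≤ F
      · have hGF := hGH.trans_le hHF
        rw [map_mul, isolate_X_of_ne hGF.ne]
        refine T.mul_mem_right _ (hCI _ (memI (.var fun h => ?_)))
        exact hGF.ne (hFmin' G (Finset.mem_of_mem_erase h) hGF.le)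
      rw [map_mul, map_pow, isolate_upperSum_of_not_le hHF, ← map_pow]
      by_cases hGF : G = F
      · subst hGF
        rw [isolate_X_self]
        exact hXJ _ (memJ (.pow (H := H) ((hmemU H).2 hGH)))
      · rw [isolate_X_of_ne hGF, ← map_mul]
        exact hCI _ (memI (.pair hGH))
    · rename_i H
      by_cases hHF : H = F
      · subst hHF
        refine Ideal.mem_sup_right ?_
        rw [map_pow, isolate_upperSum_self]
        exact Ideal.mem_span_singleton_self _
      · refine Ideal.mem_sup_left ?_
        rw [map_pow, isolate_upperSum_of_not_le (fun h => hHF (hFmin' H hH h)), ← map_pow]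
        exact hCI _ (memI (.pow (Finset.mem_erase.2 ⟨hHF, hH⟩)))
  have hcoeff : ∀ i, b F ≤ i → (isolate R F f).coeff i = 0 := by
    intro i hi
    by_contra hne
    obtain ⟨n, hn⟩ := (support_nonempty).2 hne
    obtain ⟨m, hm, rfl, -⟩ := coeff_isolate_support hn
    have h1 := hb.pos F hFP
    have h2 := (hstd m hm).lt F (by omega)
    omega
  have hdeg : (isolate R F f).degree < p.degree := by
    rw [Polynomial.degree_eq_natDegree hmonic.ne_zero, hp,
      (Polynomial.monic_X_add_C s).natDegree_pow, Polynomial.natDegree_X_add_C, mul_one,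
      Polynomial.degree_lt_iff_coeff_zero]
    exact hcoeff
  obtain ⟨hc0, hci⟩ := coeff_mem_of_mem_sup_span hmonic hJI hmem hdeg
  have hzero : isolate R F f = 0 := by
    ext1 i
    rw [Polynomial.coeff_zero]
    rcases Nat.eq_zero_or_pos i with rfl | hi
    · refine ih _ (hn ▸ hcard) P₀ hP₀up hb₀ hc0 ?_ rfl
      intro n hn
      obtain ⟨m, hm, hmF, rfl⟩ := coeff_isolate_support hn
      have hme : m.erase F = m := Finsupp.erase_of_notMem_support (by simpa using hmF)
      rw [hme]
      have hst := hstd m hm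
      exact ⟨fun H hH => Finset.mem_erase.2 ⟨by rintro rfl; exact hH hmF, hst.mem H hH⟩,
        hst.chain, hst.lt, hst.lt_sub⟩
    -- A monomial containing `x_F` has the rest of its chain above `F`, and its rank-jump condition
    -- relative to `F` becomes the bound condition for `U`.
    · refine ih _ (hn ▸ (Finset.card_le_card hUP).trans_lt hcard) U hUup hbU (hci i) ?_ rfl
      intro n hn
      obtain ⟨m, hm, hmF, rfl⟩ := coeff_isolate_support hn
      have hst := hstd m hm
      have hmF0 : m F ≠ 0 := by omega
      have hne : ∀ {H}, m.erase F H ≠ 0 → H ≠ F ∧ m H ≠ 0 ∧ m.erase F H = m H ∧ F < H := by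
        intro H hH
        have hHF : H ≠ F := by rintro rfl; simp at hH
        rw [Finsupp.erase_ne hHF] at hH ⊢
        refine ⟨hHF, hH, rfl, ?_⟩
        rcases hst.chain F H hmF0 hH with h | h
        · exact lt_of_le_of_ne h hHF.symm
        · exact absurd (hFmin' H (hst.mem H hH) h) hHF
      refine ⟨fun H hH => ?_, fun G H hG hH => ?_, fun H hH => ?_, fun G H hGH hG hH => ?_⟩
      · exact (hmemU H).2 (hne hH).2.2.2
      · exact hst.chain G H (hne hG).2.1 (hne hH).2.1
      · rw [(hne hH).2.2.1]
        exact hst.lt_sub F H (hne hH).2.2.2 hmF0 (hne hH).2.1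
      · rw [(hne hH).2.2.1]
        exact hst.lt_sub G H hGH (hne hG).2.1 (hne hH).2.1
  rw [← eval_isolate F f, hzero, Polynomial.eval_zero]

end Independence

/-! ### Spanning by the standard monomials -/

section Spanning

open MvPolynomial

/-- Every monomial of `p` has degree `d` and `r`-weight at least `n`. -/
def HasWeight {L R : Type*} [CommRing R] (r : L → ℕ) (d n : ℕ) (p : MvPolynomial L R) : Prop :=
  ∀ m ∈ p.support, m.degree = d ∧ n ≤ Finsupp.weight r m

namespace HasWeight

variable {L R : Type*} [CommRing R] {r : L → ℕ} {d d' n n' : ℕ} {p q : MvPolynomial L R}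

theorem zero : HasWeight r d n (0 : MvPolynomial L R) := by
  intro m hm
  simp at hm

theorem mono (hp : HasWeight r d n p) (h : n' ≤ n) : HasWeight r d n' p :=
  fun m hm => ⟨(hp m hm).1, h.trans (hp m hm).2⟩

theorem add (hp : HasWeight r d n p) (hq : HasWeight r d n q) : HasWeight r d n (p + q) := by
  classical
  intro m hm
  rcases Finset.mem_union.1 (support_add hm) with h | h
  exacts [hp m h, hq m h]

theorem neg (hp : HasWeight r d n p) : HasWeight r d n (-p) := by
  intro m hm
  rw [support_neg] at hm
  exact hp m hm

theorem mul (hp : HasWeight r d n p) (hq : HasWeight r d' n' q) :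
    HasWeight r (d + d') (n + n') (p * q) := by
  classical
  intro m hm
  obtain ⟨a, ha, c, hc, rfl⟩ := Finset.mem_add.1 (support_mul p q hm)
  rw [map_add, map_add]
  exact ⟨by rw [(hp a ha).1, (hq c hc).1], add_le_add (hp a ha).2 (hq c hc).2⟩

theorem sum {ι : Type*} (s : Finset ι) (f : ι → MvPolynomial L R)
    (h : ∀ i ∈ s, HasWeight r d n (f i)) : HasWeight r d n (∑ i ∈ s, f i) := by
  classical
  intro m hm
  obtain ⟨i, hi, hmi⟩ := Finset.mem_biUnion.1 (support_sum hm)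
  exact h i hi m hmi

theorem monomial (m : L →₀ ℕ) (c : R) :
    HasWeight r m.degree (Finsupp.weight r m) (monomial m c) := by
  intro m' hm'
  have : m' = m := by simpa using support_monomial_subset hm'
  subst this
  exact ⟨rfl, le_rfl⟩

theorem X (H : L) : HasWeight r 1 (r H) (X H : MvPolynomial L R) := by
  have := monomial (r := r) (Finsupp.single H 1) (1 : R)
  simpa [Finsupp.weight_apply, MvPolynomial.X] using this

end HasWeight

variable {L : Type*} [SemilatticeSup L] [Fintype L] {R : Type*} [CommRing R]

/-- Replacing `x_H` by `h_H` costs only variables strictly above `H`, which have larger rank. This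
is the strict increase that drives the straightening. -/
theorem hasWeight_X_sub_upperSum {r : L → ℕ} (hr : StrictMono r) (H : L) :
    HasWeight r 1 (r H + 1) (X H - upperSum R H) := by
  classical
  rw [upperSum_eq, sub_add_cancel_left]
  refine HasWeight.neg (HasWeight.sum _ _ fun G hG => (HasWeight.X G).mono ?_)
  exact hr (by simpa using hG)

theorem hasWeight_X_pow_sub_upperSum_pow {r : L → ℕ} (hr : StrictMono r) (H : L) (e : ℕ) :
    HasWeight r e (e * r H) (X H ^ e : MvPolynomial L R) ∧
      HasWeight r e (e * r H + 1) (X H ^ e - upperSum R H ^ e) := by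
  have hs := hasWeight_X_sub_upperSum (R := R) hr H
  have hH : HasWeight r 1 (r H) (upperSum R H) := by
    have := (HasWeight.X (r := r) (R := R) H).add (hs.mono (Nat.le_succ _)).neg
    simpa using this
  induction e with
  | zero =>
    refine ⟨?_, by simpa using HasWeight.zero⟩
    simpa using HasWeight.monomial (r := r) (0 : L →₀ ℕ) (1 : R)
  | succ e ih =>
    constructor
    · rw [pow_succ, add_mul, one_mul]
      exact ih.1.mul (HasWeight.X H)
    · have h : (X H ^ (e + 1) - upperSum R H ^ (e + 1) : MvPolynomial L R) =
          X H ^ e * (X H - upperSum R H) + (X H ^ e - upperSum R H ^ e) * upperSum R H := by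
        ring
      rw [h, add_mul, one_mul]
      refine HasWeight.add ((ih.1.mul hs).mono (by omega)) ((ih.2.mul hH).mono (by omega))

theorem weight_le_degree_mul {L : Type*} {r : L → ℕ} {N : ℕ} (hN : ∀ H, r H ≤ N) (m : L →₀ ℕ) :
    Finsupp.weight r m ≤ m.degree * N := by
  rw [Finsupp.weight_apply, Finsupp.degree_apply, Finsupp.sum, Finset.sum_mul]
  exact Finset.sum_le_sum fun H _ => by simpa using Nat.mul_le_mul_left _ (hN H)

/-- Modulo the straightening relations, every monomial is a combination of standard ones. -/
theorem monomial_mem_span_standard {r b : L → ℕ} (hr : StrictMono r)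
    {K : Ideal (MvPolynomial L R)} (hK : relatorIdeal R r b Set.univ ≤ K) (m : L →₀ ℕ) :
    monomial m (1 : R) ∈ Submodule.span R
      ((fun n => monomial n (1 : R)) '' {n | IsStandard r b Set.univ n ∧ n.degree = m.degree}) ⊔
        K.restrictScalars R := by
  classical
  have memK : ∀ {p}, Relator R r b Set.univ p → p ∈ K := fun h => hK (Ideal.subset_span h)
  -- In a fixed degree the weight is at most degree times `N`, so raising the weight must terminate.
  set N := Finset.univ.sup r with hN
  have hrN : ∀ H, r H ≤ N := fun H => Finset.le_sup (Finset.mem_univ H)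
  induction hn : m.degree * N - Finsupp.weight r m using Nat.strong_induction_on
    generalizing m with
  | _ n ih =>
  by_cases hstd : IsStandard r b Set.univ m
  · exact Submodule.mem_sup_left (Submodule.subset_span ⟨m, ⟨hstd, rfl⟩, rfl⟩)
  have hsplit : ∀ G, m G ≠ 0 → m = m - Finsupp.single G 1 + Finsupp.single G 1 := by
    intro G hG
    refine (tsub_add_cancel_of_le ?_).symm
    rw [Finsupp.single_le_iff]
    omega
  by_cases hchain : ∃ G H, m G ≠ 0 ∧ m H ≠ 0 ∧ ¬ G ≤ H ∧ ¬ H ≤ G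
  · obtain ⟨G, H, hG, hH, hGH, hHG⟩ := hchain
    refine Submodule.mem_sup_right ?_
    have hne : G ≠ H := fun h => hGH h.le
    have h1 := hsplit G hG
    have h2 : m - Finsupp.single G 1 =
        m - Finsupp.single G 1 - Finsupp.single H 1 + Finsupp.single H 1 := by
      refine (tsub_add_cancel_of_le ?_).symm
      rw [Finsupp.single_le_iff]
      simp [hne.symm]
      omega
    rw [h2] at h1
    have h3 : monomial m (1 : R) =
        monomial (m - Finsupp.single G 1 - Finsupp.single H 1) 1 * (X G * X H) := by
      conv_lhs => rw [h1]
      simp only [X, monomial_mul, mul_one]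
      congr 1
      rw [add_assoc, add_comm (Finsupp.single H 1)]
    rw [h3]
    exact K.mul_mem_left _ (memK (.incomp hGH hHG))
  -- The support is now a chain, so some exponent is too large. Take `e` to be the violated bound:
  -- `b H`, or `r H - r G` with a factor `x_G` left in `m'`.
  have key : ∃ (m' : L →₀ ℕ) (H : L) (e : ℕ), m = m' + Finsupp.single H e ∧
      monomial m' (1 : R) * upperSum R H ^ e ∈ K := by
    by_contra hcon
    refine hstd ⟨fun _ _ => trivial, fun G H hG hH => ?_, fun H _ => ?_, fun G H hGH hG _ => ?_⟩
    · by_contra h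
      rw [not_or] at h
      exact hchain ⟨G, H, hG, hH, h.1, h.2⟩
    · by_contra hlt
      refine hcon ⟨m - Finsupp.single H (b H), H, b H, (tsub_add_cancel_of_le ?_).symm,
        K.mul_mem_left _ (memK (.pow trivial))⟩
      rw [Finsupp.single_le_iff]
      omega
    · by_contra hlt
      refine hcon ⟨m - Finsupp.single H (r H - r G), H, r H - r G,
        (tsub_add_cancel_of_le ?_).symm, ?_⟩
      · rw [Finsupp.single_le_iff]
        omega
      · have h1 : m - Finsupp.single H (r H - r G) =
            m - Finsupp.single H (r H - r G) - Finsupp.single G 1 + Finsupp.single G 1 := by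
          refine (tsub_add_cancel_of_le ?_).symm
          rw [Finsupp.single_le_iff]
          simp [hGH.ne]
          omega
        have h2 : monomial (m - Finsupp.single H (r H - r G)) (1 : R) =
            monomial (m - Finsupp.single H (r H - r G) - Finsupp.single G 1) 1 * X G := by
          conv_lhs => rw [h1]
          simp [X, monomial_mul]
        rw [h2, mul_assoc]
        exact K.mul_mem_left _ (memK (.pair hGH))
  obtain ⟨m', H, e, hm, hmem⟩ := key
  have hdecomp : monomial m (1 : R) = monomial m' 1 * (X H ^ e - upperSum R H ^ e) +
      monomial m' 1 * upperSum R H ^ e := by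
    rw [← mul_add, sub_add_cancel, X_pow_eq_monomial, monomial_mul, mul_one, ← hm]
  have hwt := (HasWeight.monomial (r := r) m' (1 : R)).mul
    (hasWeight_X_pow_sub_upperSum_pow (R := R) hr H e).2
  have hdeg : m.degree = m'.degree + e := by rw [hm, map_add, Finsupp.degree_single]
  have hweight : Finsupp.weight r m = Finsupp.weight r m' + e * r H := by
    rw [hm, map_add]
    simp [Finsupp.weight_apply]
  rw [hdecomp]
  refine Submodule.add_mem _ ?_ (Submodule.mem_sup_right hmem)
  rw [MvPolynomial.as_sum (monomial m' 1 * (X H ^ e - upperSum R H ^ e))]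
  refine Submodule.sum_mem _ fun k hk => ?_
  obtain ⟨hk1, hk2⟩ := hwt k hk
  rw [← mul_one (coeff k _), ← smul_eq_mul, ← smul_monomial]
  refine Submodule.smul_mem _ _ ?_
  have h1 := weight_le_degree_mul hrN k
  have h2 := ih (k.degree * N - Finsupp.weight r k)
    (by rw [hk1, ← hdeg] at h1 ⊢; omega) k rfl
  rwa [hk1, ← hdeg] at h2

end Spanning

/-! ### Hilbert functions as counts of standard exponents -/

section Dimension

open MvPolynomial

variable {L : Type*} [SemilatticeSup L] [Fintype L] {k : Type*} [Field k]

/-- A graded quotient of `k[L ⊔ E]` whose ideal restricts to the straightening relations has the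
standard monomials as a basis. -/
theorem finrank_map_homogeneousSubmodule {E A : Type*} [CommRing A] [Algebra k A] {r b : L → ℕ}
    (hr : StrictMono r) (hsub : ∀ B F G : L, B ≤ F → B ≤ G → r (G ⊔ F) + r B ≤ r F + r G)
    (hb : IsBound r b Set.univ) (q : MvPolynomial (L ⊕ E) k →ₐ[k] A)
    (l : E → MvPolynomial L k) (hl : ∀ e, (l e).IsHomogeneous 1)
    (hq : ∀ e, q (X (Sum.inr e)) = q (rename Sum.inl (l e)))
    (hrel : ∀ p, Relator k r b Set.univ p → q (rename Sum.inl p) = 0)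
    (hker : ∀ p, q p = 0 → aeval (Sum.elim X l) p ∈ relatorIdeal k r b Set.univ) (d : ℕ) :
    Module.finrank k ((homogeneousSubmodule (L ⊕ E) k d).map q.toLinearMap) =
      Nat.card {m : L →₀ ℕ // IsStandard r b Set.univ m ∧ m.degree = d} := by
  classical
  -- Substituting linear forms for the variables indexed by `E` preserves degree and does not change
  -- the image under `q`.
  set σ : MvPolynomial (L ⊕ E) k →ₐ[k] MvPolynomial L k := aeval (Sum.elim X l) with hσ
  set π : MvPolynomial L k →ₐ[k] A := q.comp (rename Sum.inl) with hπ
  have hπσ : π.comp σ = q := by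
    ext i
    rcases i with F | e
    · simp [hπ, hσ]
    · simp [hπ, hσ, hq]
  have hσrename : ∀ p, σ (rename Sum.inl p) = p := by
    intro p
    rw [hσ, aeval_rename]
    exact aeval_X_left_apply p
  have hkerπ : ∀ p, π p = 0 ↔ p ∈ relatorIdeal k r b Set.univ := by
    intro p
    constructor
    · intro h
      have := hker _ h
      change σ (rename Sum.inl p) ∈ _ at this
      rwa [hσrename] at this
    · intro h
      have : relatorIdeal k r b Set.univ ≤ RingHom.ker π := by
        rw [relatorIdeal, Ideal.span_le]
        exact fun p hp => hrel p hp
      exact this h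
  set v : {m : L →₀ ℕ // IsStandard r b Set.univ m ∧ m.degree = d} → A :=
    fun m => π (monomial m.1 1) with hv
  have hspan : (homogeneousSubmodule (L ⊕ E) k d).map q.toLinearMap =
      Submodule.span k (Set.range v) := by
    refine le_antisymm ?_ ?_
    · rintro _ ⟨p, hp, rfl⟩
      have hσp : (σ p).IsHomogeneous d := by
        have h := IsHomogeneous.aeval (m := d) (n := 1) hp (Sum.elim X l) (by
          rintro (F | e)
          · exact isHomogeneous_X _ _
          · exact hl e)
        rwa [one_mul] at h
      have hqp : q.toLinearMap p = π (σ p) := by rw [← AlgHom.comp_apply, hπσ]; rfl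
      rw [hqp, (σ p).as_sum, map_sum]
      refine Submodule.sum_mem _ fun m hm => ?_
      rw [← mul_one (coeff m _), ← smul_eq_mul, ← smul_monomial, map_smul]
      refine Submodule.smul_mem _ _ ?_
      have hdeg : m.degree = d := by
        have := hσp (mem_support_iff.1 hm)
        rw [Finsupp.degree_eq_weight_one]
        exact this
      have h := Submodule.mem_map_of_mem (f := π.toLinearMap)
        (monomial_mem_span_standard (R := k) (b := b) hr le_rfl m)
      rw [Submodule.map_sup, Submodule.map_span] at h
      have h0 : ((relatorIdeal k r b Set.univ).restrictScalars k).map π.toLinearMap = ⊥ := by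
        rw [eq_bot_iff]
        rintro _ ⟨p, hp, rfl⟩
        exact (hkerπ p).2 hp
      rw [h0, sup_bot_eq, hdeg] at h
      refine Submodule.span_mono ?_ h
      rintro _ ⟨_, ⟨n, hn, rfl⟩, rfl⟩
      exact ⟨⟨n, hn⟩, rfl⟩
    · rw [Submodule.span_le]
      rintro _ ⟨m, rfl⟩
      refine ⟨rename Sum.inl (monomial m.1 1), ?_, rfl⟩
      exact (isHomogeneous_monomial _ m.2.2).rename_isHomogeneous
  have hli : LinearIndependent k v := by
    rw [linearIndependent_iff]
    intro c hc
    set f : MvPolynomial L k := c.sum fun m a => monomial m.1 a with hf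
    have hcoeff : ∀ m, f.coeff m.1 = c m := by
      intro m
      rw [hf, Finsupp.sum, coeff_sum]
      simp only [coeff_monomial]
      rw [Finset.sum_eq_single m]
      · simp
      · intro n _ hn
        rw [if_neg (fun h => hn (Subtype.ext h))]
      · intro h
        simpa using h
    have hπf : π f = 0 := by
      rw [← hc, hf, Finsupp.linearCombination_apply, Finsupp.sum, map_sum, Finsupp.sum]
      refine Finset.sum_congr rfl fun m _ => ?_
      rw [hv, ← map_smul, smul_monomial, smul_eq_mul, mul_one]
    have hf0 : f = 0 := by
      refine eq_zero_of_mem_relatorIdeal hr hsub Finset.univ (by simpa using isUpperSet_univ)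
        (b := b) (by simpa using hb) (by simpa using (hkerπ f).1 hπf) ?_
      intro m hm
      rw [hf, Finsupp.sum] at hm
      obtain ⟨n, _, hnm⟩ := Finset.mem_biUnion.1 (support_sum hm)
      have : m = n.1 := by simpa using support_monomial_subset hnm
      rw [this]
      simpa using n.2.1
    ext m
    rw [← hcoeff, hf0]
    simp
  rw [hspan, Module.finrank_eq_nat_card_basis (Module.Basis.span hli)]

end Dimension

/-! ### Deriving the straightening relations from the defining ones -/

section Relations

open MvPolynomial

variable {L : Type*} [SemilatticeSup L] [Fintype L] {R : Type*} [CommRing R]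

/-- An ideal containing the quadratic monomials of incomparable pairs and the products
`x_F h_a` for the atoms `a` not below `F`. -/
structure IsChowIdeal (r : L → ℕ) (At : Set L) (K : Ideal (MvPolynomial L R)) : Prop where
  incomp : ∀ G H : L, ¬ G ≤ H → ¬ H ≤ G → (X G * X H : MvPolynomial L R) ∈ K
  atom : ∀ a ∈ At, ∀ F, ¬ a ≤ F → (X F * upperSum R a : MvPolynomial L R) ∈ K
  exists_cover : ∀ G H : L, G < H →
    ∃ H' a, a ∈ At ∧ G ≤ H' ∧ ¬ a ≤ H' ∧ H' ⊔ a = H ∧ r H = r H' + 1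

namespace IsChowIdeal

variable {r : L → ℕ} {At : Set L} {K : Ideal (MvPolynomial L R)}

/-- A variable `x_G` of `h_H - h_(H ⊔ a)` has `H ≤ G` and not `a ≤ G`. Modulo `K`, both `x_G h_(H ⊔
a)` and `x_G h_a` equal `x_G h_(G ⊔ a)`, and `x_G h_a` is in `K`. -/
theorem upperSum_mul_sub_mem (hK : IsChowIdeal r At K) {H a : L} (ha : a ∈ At) :
    upperSum R (H ⊔ a) * upperSum R (H ⊔ a) - upperSum R (H ⊔ a) * upperSum R H ∈ K := by
  classical
  have hs : (Finset.univ.filter fun G : L => H ⊔ a ≤ G) ⊆ Finset.univ.filter fun G => H ≤ G := by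
    intro G hG
    simp only [Finset.mem_filter, Finset.mem_univ, true_and] at hG ⊢
    exact le_sup_left.trans hG
  have hd : upperSum R H - upperSum R (H ⊔ a) = ∑ G ∈ (Finset.univ.filter fun G : L => H ≤ G) \
      Finset.univ.filter fun G => H ⊔ a ≤ G, X G := by
    rw [upperSum, upperSum, ← Finset.sum_sdiff hs, add_sub_cancel_right]
  rw [← mul_sub, ← neg_sub, mul_neg, neg_mem_iff, hd, Finset.mul_sum]
  refine K.sum_mem fun G hG => ?_
  simp only [Finset.mem_sdiff, Finset.mem_filter, Finset.mem_univ, true_and] at hG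
  have haG : ¬ a ≤ G := fun h => hG.2 (sup_le hG.1 h)
  have h1 := upperSum_sub_mem hK.incomp haG
  have h2 := upperSum_sub_mem hK.incomp hG.2
  rw [← sup_assoc, sup_eq_left.2 hG.1] at h2
  have h3 := K.add_mem (K.sub_mem h2 h1) (hK.atom a ha G haG)
  rw [mul_comm]
  convert h3 using 1
  ring

theorem upperSum_mul_pow_sub_mem (hK : IsChowIdeal r At K) {H a : L} (ha : a ∈ At) (n : ℕ) :
    upperSum R (H ⊔ a) ^ (n + 1) - upperSum R (H ⊔ a) * upperSum R H ^ n ∈ K := by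
  have := mul_pow_sub_mem (hK.upperSum_mul_sub_mem (H := H) ha) n
  rwa [← pow_succ'] at this

/-- Climb from `G` to `H` one atom at a time. Each step raises the rank by one and trades all but
one factor `h_H` for `h_(H')`, so one extra power suffices. -/
theorem pair_mem (hK : IsChowIdeal r At K) (hr : StrictMono r) (G H : L) (hGH : G < H) :
    X G * upperSum R H ^ (r H - r G) ∈ K := by
  induction hn : r H using Nat.strong_induction_on generalizing H with
  | _ n ih =>
  subst hn
  obtain ⟨H', a, ha, hG, haH, rfl, hrH⟩ := hK.exists_cover G H hGH
  rcases hG.eq_or_lt with rfl | hlt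
  · rw [hrH, Nat.add_sub_cancel_left, pow_one]
    have h1 := upperSum_sub_mem hK.incomp haH
    simpa using K.sub_mem (hK.atom a ha G haH) h1
  · have h1 := ih (r H') (by omega) H' hlt rfl
    have h2 := hr hlt
    obtain ⟨n, hn⟩ : ∃ n, r H' - r G = n := ⟨_, rfl⟩
    rw [show r (H' ⊔ a) - r G = n + 1 by omega]
    rw [hn] at h1
    have h3 := K.mul_mem_left (X G) (hK.upperSum_mul_pow_sub_mem (H := H') ha n)
    have h4 := K.add_mem h3 (K.mul_mem_left (upperSum R (H' ⊔ a)) h1)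
    convert h4 using 1
    ring

variable [OrderBot L]

theorem pow_succ_mem (hK : IsChowIdeal r At K) (hbot : upperSum R (⊥ : L) ∈ K) (H : L) :
    upperSum R H ^ (r H + 1) ∈ K := by
  induction hn : r H using Nat.strong_induction_on generalizing H with
  | _ n ih =>
  subst hn
  rcases (bot_le : ⊥ ≤ H).eq_or_lt with rfl | hlt
  · exact Ideal.pow_mem_of_mem _ hbot _ (by omega)
  obtain ⟨H', a, ha, -, haH, rfl, hrH⟩ := hK.exists_cover ⊥ H hlt
  have h1 := ih (r H') (by omega) H' rfl
  have h2 := hK.upperSum_mul_pow_sub_mem (H := H') ha (r H' + 1)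
  rw [hrH]
  simpa using K.add_mem h2 (K.mul_mem_left (upperSum R (H' ⊔ a)) h1)

/-- The same climb saves one power over `pow_succ_mem`, since it can start at an atom, where `h_a`
itself is in `K`. -/
theorem pow_max_mem (hK : IsChowIdeal r At K) (hbot : upperSum R (⊥ : L) ∈ K)
    (hat : ∀ a ∈ At, upperSum R a ∈ K) (H : L) : upperSum R H ^ max 1 (r H) ∈ K := by
  induction hn : r H using Nat.strong_induction_on generalizing H with
  | _ n ih =>
  subst hn
  rcases (bot_le : ⊥ ≤ H).eq_or_lt with rfl | hlt
  · exact Ideal.pow_mem_of_mem _ hbot _ (by omega)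
  obtain ⟨H', a, ha, -, haH, rfl, hrH⟩ := hK.exists_cover ⊥ H hlt
  rcases (bot_le : ⊥ ≤ H').eq_or_lt with rfl | hlt'
  · rw [bot_sup_eq]
    exact Ideal.pow_mem_of_mem _ (hat a ha) _ (by omega)
  -- Used only for `1 ≤ r H'`, which resolves both maxima.
  obtain ⟨H'', -, -, -, -, -, hrH'⟩ := hK.exists_cover ⊥ H' hlt'
  have h1 := ih (r H') (by omega) H' rfl
  rw [max_eq_right (by omega)] at h1 ⊢
  have h2 := hK.upperSum_mul_pow_sub_mem (H := H') ha (r H')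
  rw [hrH]
  simpa using K.add_mem h2 (K.mul_mem_left (upperSum R (H' ⊔ a)) h1)

end IsChowIdeal

end Relations

/-! ### The lattice of flats and its rank function -/

section Flats

variable {E : Type*} {M : Matroid E}

instance : SemilatticeSup (Flat M) :=
  { (inferInstance : PartialOrder (Flat M)) with
    sup := fun F G => ⟨M.closure (F.1 ∪ G.1), M.isFlat_closure _⟩
    le_sup_left := fun F G => Set.subset_union_left.trans
      (M.subset_closure _ (Set.union_subset F.2.subset_ground G.2.subset_ground))
    le_sup_right := fun F G => Set.subset_union_right.trans
      (M.subset_closure _ (Set.union_subset F.2.subset_ground G.2.subset_ground))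
    sup_le := fun F G H h1 h2 => by
      have := M.closure_subset_closure (Set.union_subset h1 h2)
      rwa [H.2.closure] at this }

instance : OrderBot (Flat M) where
  bot := ⟨M.closure ∅, M.isFlat_closure _⟩
  bot_le F := by
    have := M.closure_subset_closure (Set.empty_subset F.1)
    rwa [F.2.closure] at this

theorem flat_coe_sup (F G : Flat M) : (F ⊔ G).1 = M.closure (F.1 ∪ G.1) := rfl

theorem flat_coe_bot : (⊥ : Flat M).1 = M.closure ∅ := rfl

/-- The rank of a flat. -/
noncomputable def flatRank (F : Flat M) : ℕ := (M.eRk F.1).toNat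

/-- The flat spanned by an element. -/
def pointFlat (M : Matroid E) (e : E) : Flat M := ⟨M.closure {e}, M.isFlat_closure _⟩

theorem pointFlat_le_iff (hM : M.E = Set.univ) {e : E} {F : Flat M} :
    pointFlat M e ≤ F ↔ e ∈ F.1 := by
  have he : e ∈ M.E := hM ▸ Set.mem_univ e
  constructor
  · exact fun h => h (M.mem_closure_of_mem' (Set.mem_singleton e) he)
  · intro h
    have := M.closure_subset_closure (Set.singleton_subset_iff.2 h)
    rwa [F.2.closure] at this

variable [Finite E]

theorem eRk_ne_top_of_finite (M : Matroid E) (S : Set E) : M.eRk S ≠ ⊤ :=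
  ((M.eRk_le_encard S).trans_lt (Set.encard_lt_top_iff.2 S.toFinite)).ne

theorem coe_flatRank (F : Flat M) : (flatRank F : ℕ∞) = M.eRk F.1 :=
  ENat.natCast_toNat (eRk_ne_top_of_finite M _)

theorem flatRank_strictMono : StrictMono (flatRank : Flat M → ℕ) := by
  intro F G hFG
  by_contra hle
  rw [not_lt, ← Nat.cast_le (α := ℕ∞), coe_flatRank, coe_flatRank] at hle
  have hfin : M.IsRkFinite F.1 := Matroid.eRk_ne_top_iff.1 (eRk_ne_top_of_finite M _)
  have := hfin.closure_eq_closure_of_subset_of_eRk_ge_eRk hFG.le hle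
  rw [F.2.closure, G.2.closure] at this
  exact hFG.ne (Subtype.ext this)

theorem flatRank_sup_add_le (B F G : Flat M) (hF : B ≤ F) (hG : B ≤ G) :
    flatRank (G ⊔ F) + flatRank B ≤ flatRank F + flatRank G := by
  rw [← Nat.cast_le (α := ℕ∞)]
  push_cast
  simp only [coe_flatRank, flat_coe_sup, Matroid.eRk_closure_eq]
  refine le_trans ?_ (M.eRk_inter_add_eRk_union_le F.1 G.1)
  rw [add_comm, Set.union_comm]
  exact add_le_add (M.eRk_mono (Set.subset_inter hF hG)) le_rfl

theorem flatRank_bot : flatRank (⊥ : Flat M) = 0 := by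
  rw [← Nat.cast_inj (R := ℕ∞), coe_flatRank, flat_coe_bot, Matroid.eRk_closure_eq]
  simp

/-- Extend a basis of `G` to a basis `J` of `H`, and drop from `J` an element `e` outside the basis
of `G`; the closure of the rest is the required `H'`. -/
theorem exists_flat_cover (G H : Flat M) (hGH : G < H) :
    ∃ (H' : Flat M) (e : E), M.IsNonloop e ∧ G ≤ H' ∧ ¬ pointFlat M e ≤ H' ∧
      H' ⊔ pointFlat M e = H ∧ flatRank H = flatRank H' + 1 := by
  obtain ⟨I, hI⟩ := M.exists_isBasis G.1 G.2.subset_ground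
  obtain ⟨J, hJ, hIJ⟩ := hI.indep.subset_isBasis_of_subset (hI.subset.trans hGH.le)
    H.2.subset_ground
  have hne : I ≠ J := by
    rintro rfl
    have := hI.closure_eq_closure.symm.trans hJ.closure_eq_closure
    rw [G.2.closure, H.2.closure] at this
    exact hGH.ne (Subtype.ext this)
  obtain ⟨e, heJ, heI⟩ := Set.exists_of_ssubset (hIJ.ssubset_of_ne hne)
  have heE : e ∈ M.E := hJ.indep.subset_ground heJ
  have hsub : I ⊆ J \ {e} := fun i hi => ⟨hIJ hi, by rintro rfl; exact heI hi⟩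
  have hnot : e ∉ M.closure (J \ {e}) := hJ.indep.notMem_closure_sdiff_of_mem heJ
  refine ⟨⟨M.closure (J \ {e}), M.isFlat_closure _⟩, e, hJ.indep.isNonloop_of_mem heJ, ?_, ?_,
    ?_, ?_⟩
  · have := M.closure_subset_closure hsub
    rwa [hI.closure_eq_closure, G.2.closure] at this
  · exact fun h => hnot (h (M.mem_closure_of_mem' (Set.mem_singleton e) heE))
  · refine Subtype.ext ?_
    rw [flat_coe_sup, pointFlat]
    simp only [Matroid.closure_union_closure_left_eq, Matroid.closure_union_closure_right_eq]
    rw [Set.sdiff_union_self, Set.union_eq_self_of_subset_right (Set.singleton_subset_iff.2 heJ),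
      hJ.closure_eq_closure, H.2.closure]
  · rw [← Nat.cast_inj (R := ℕ∞)]
    push_cast
    rw [coe_flatRank, coe_flatRank, Matroid.eRk_closure_eq, ← hJ.encard_eq_eRk,
      (hJ.indep.subset Set.sdiff_subset).eRk_eq_encard, Set.encard_sdiff_singleton_add_one heJ]

theorem flatRank_pointFlat {e : E} (he : M.IsNonloop e) : flatRank (pointFlat M e) = 1 := by
  rw [← Nat.cast_inj (R := ℕ∞), coe_flatRank, pointFlat, Matroid.eRk_closure_eq, he.eRk_eq]
  rfl

theorem isBound_succ :
    IsBound (flatRank : Flat M → ℕ) (fun F => flatRank F + 1) Set.univ := by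
  refine ⟨fun F _ => Nat.succ_pos _, fun F _ G _ _ => ?_, fun F _ H _ _ => by omega⟩
  have := flatRank_sup_add_le ⊥ F G bot_le bot_le
  omega

theorem isBound_max :
    IsBound (flatRank : Flat M → ℕ) (fun F => max 1 (flatRank F)) Set.univ := by
  refine ⟨fun F _ => by simp, fun F _ G _ _ => ?_, fun F _ H _ h => ?_⟩
  · have := flatRank_sup_add_le ⊥ F G bot_le bot_le
    omega
  · have := flatRank_strictMono h
    omega

end Flats

/-! ### Monomial bases of the Chow ring and the augmented Chow ring -/

section ChowRings

open MvPolynomial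

variable {E : Type*} {M : Matroid E}

open Classical in
/-- The linear form `∑_{F ∌ e} x_F`. -/
noncomputable def avoidingSum (M : Matroid E) [Fintype (Flat M)] (e : E) :
    MvPolynomial (Flat M) ℚ :=
  ∑ F : Flat M with e ∉ F.1, X F

/-- Eliminate the variables `y_e`. -/
noncomputable def eliminate (M : Matroid E) [Fintype (Flat M)] :
    PolyRing M →ₐ[ℚ] MvPolynomial (Flat M) ℚ :=
  aeval (Sum.elim X (avoidingSum M))

theorem finrank_chowRingPiece_of_not_loopless (hl : ¬ M.Loopless) (d : ℕ) :
    Module.finrank ℚ (chowRingPiece M d) = 0 := by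
  have : Subsingleton (ChowRing M) := by
    rw [Ideal.Quotient.subsingleton_iff, chowIdeal, if_neg hl]
  exact Module.finrank_zero_of_subsingleton

variable [Fintype (Flat M)]

theorem avoidingSum_isHomogeneous (e : E) : (avoidingSum M e).IsHomogeneous 1 :=
  IsHomogeneous.sum _ _ _ fun F _ => isHomogeneous_X _ F

theorem upperSum_bot_eq : upperSum ℚ (⊥ : Flat M) = ∑ F, X F := by
  simp [upperSum]

theorem avoidingSum_eq (hM : M.E = Set.univ) (e : E) :
    avoidingSum M e = upperSum ℚ (⊥ : Flat M) - upperSum ℚ (pointFlat M e) := by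
  classical
  rw [upperSum_bot_eq, eq_sub_iff_add_eq, add_comm, upperSum, avoidingSum,
    ← Finset.sum_filter_add_sum_filter_not Finset.univ (fun F : Flat M => pointFlat M e ≤ F)]
  simp only [pointFlat_le_iff hM]

theorem finsum_x : ∑ᶠ F : Flat M, x F = rename Sum.inl (upperSum ℚ (⊥ : Flat M)) := by
  rw [finsum_eq_sum_of_fintype, upperSum_bot_eq, map_sum]
  simp [x]

theorem finsum_avoiding_x (e : E) :
    ∑ᶠ (F : Flat M) (_ : e ∉ F.1), x F = rename Sum.inl (avoidingSum M e) := by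
  classical
  rw [finsum_eq_sum_of_fintype, avoidingSum, map_sum, Finset.sum_filter]
  refine Finset.sum_congr rfl fun F _ => ?_
  rw [finsum_eq_if]
  simp [x]

theorem eliminate_rename (p : MvPolynomial (Flat M) ℚ) : eliminate M (rename Sum.inl p) = p := by
  rw [eliminate, aeval_rename]
  exact aeval_X_left_apply p

variable [Finite E]

/-- Only `b ⊥ = 1` matters here, which puts `h_⊥` into the ideal; so both choices of `b` are
covered. -/
theorem augChowIdeal_le_comap (hM : M.E = Set.univ) {b : Flat M → ℕ} (hb : b ⊥ = 1) :
    augChowIdeal M ≤ (relatorIdeal ℚ flatRank b Set.univ).comap (eliminate M) := by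
  set I := relatorIdeal ℚ (flatRank : Flat M → ℕ) b Set.univ with hI
  have memI : ∀ {p}, Relator ℚ flatRank b Set.univ p → p ∈ I := fun h => Ideal.subset_span h
  have hbot : upperSum ℚ (⊥ : Flat M) ∈ I := by
    have := memI (.pow (Set.mem_univ ⊥))
    rwa [hb, pow_one] at this
  have hx : ∀ F : Flat M, eliminate M (x F) = X F := fun F => by simp [eliminate, x]
  have hy : ∀ e : E, eliminate M (y M e) = avoidingSum M e := fun e => by simp [eliminate, y]
  refine sup_le (sup_le (sup_le ?_ ?_) ?_) ?_ <;> rw [Ideal.span_le]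
  · rintro _ rfl
    change eliminate M _ ∈ I
    rwa [finsum_x, eliminate_rename]
  · rintro _ ⟨e, rfl⟩
    change eliminate M _ ∈ I
    rw [finsum_avoiding_x, map_sub, eliminate_rename, hy, sub_self]
    exact I.zero_mem
  · rintro _ ⟨e, F, heF, rfl⟩
    change eliminate M _ ∈ I
    rw [map_mul, hx, hy, avoidingSum_eq hM, sub_mul]
    refine I.sub_mem (I.mul_mem_right _ hbot) ?_
    have hle : ¬ pointFlat M e ≤ F := by rwa [pointFlat_le_iff hM]
    -- A loop lies in every flat, while `e ∉ F`. Hence joining `e` to `F` raises the rank by at most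
    -- one, and the first power of `h_a` already kills `x_F`.
    have hnl : M.IsNonloop e := by
      rw [← Matroid.not_isLoop_iff (hM ▸ Set.mem_univ e)]
      exact fun h => heF (h.mem_of_isFlat F.2)
    have := X_mul_upperSum_pow_mem (R := ℚ) (r := flatRank) (K := I)
      (fun G H h1 h2 => memI (.incomp h1 h2)) (fun G H h => memI (.pair h)) hle (n := 1) (by
        have h1 := flatRank_sup_add_le ⊥ (pointFlat M e) F bot_le bot_le
        rw [flatRank_pointFlat hnl] at h1
        omega)
    rwa [pow_one, mul_comm] at this
  · rintro _ ⟨F, G, h1, h2, rfl⟩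
    change eliminate M _ ∈ I
    rw [map_mul, hx, hx]
    exact memI (.incomp h1 h2)

/-- The ideal of relations between the `x_F` in a quotient of the augmented Chow ring. -/
theorem isChowIdeal_ker {A : Type*} [CommRing A] [Algebra ℚ A] (hM : M.E = Set.univ)
    (q : PolyRing M →ₐ[ℚ] A) (hq : ∀ p ∈ augChowIdeal M, q p = 0) :
    upperSum ℚ (⊥ : Flat M) ∈ RingHom.ker (q.comp (rename Sum.inl)) ∧
    (∀ e, q (y M e) = q (rename Sum.inl (avoidingSum M e))) ∧
    IsChowIdeal flatRank {a | ∃ e, M.IsNonloop e ∧ a = pointFlat M e}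
      (RingHom.ker (q.comp (rename Sum.inl : MvPolynomial (Flat M) ℚ →ₐ[ℚ] PolyRing M))) := by
  have h1 : upperSum ℚ (⊥ : Flat M) ∈ RingHom.ker (q.comp (rename Sum.inl)) := by
    refine hq _ (Ideal.mem_sup_left (Ideal.mem_sup_left (Ideal.mem_sup_left ?_)))
    exact Ideal.subset_span finsum_x.symm
  have h2 : ∀ e, q (y M e) = q (rename Sum.inl (avoidingSum M e)) := fun e => by
    rw [← sub_eq_zero, ← map_sub, ← finsum_avoiding_x]
    exact hq _ (Ideal.mem_sup_left (Ideal.mem_sup_left (Ideal.mem_sup_right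
      (Ideal.subset_span ⟨e, rfl⟩))))
  refine ⟨h1, h2, ⟨fun G H hGH hHG => ?_, ?_, fun G H hGH => ?_⟩⟩
  · change q (rename Sum.inl _) = 0
    rw [map_mul, rename_X, rename_X]
    exact hq _ (Ideal.mem_sup_right (Ideal.subset_span ⟨G, H, hGH, hHG, rfl⟩))
  · rintro _ ⟨e, he, rfl⟩ F hF
    have h3 : q (y M e * x F) = 0 := hq _ (Ideal.mem_sup_left (Ideal.mem_sup_right
      (Ideal.subset_span ⟨e, F, by rwa [pointFlat_le_iff hM] at hF, rfl⟩)))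
    have h1' : q (rename Sum.inl (upperSum ℚ (⊥ : Flat M))) = 0 := h1
    change q (rename Sum.inl _) = 0
    rw [map_mul, h2, avoidingSum_eq hM, map_sub, map_sub, h1', zero_sub, neg_mul,
      neg_eq_zero] at h3
    rw [map_mul, rename_X, map_mul, mul_comm]
    exact h3
  · obtain ⟨H', e, he, h⟩ := exists_flat_cover G H hGH
    exact ⟨H', pointFlat M e, ⟨e, he, rfl⟩, h⟩

omit [Fintype (Flat M)] in
theorem finrank_augChowRingPiece (hM : M.E = Set.univ) (d : ℕ) :
    Module.finrank ℚ (augChowRingPiece M d) = Nat.card {m : Flat M →₀ ℕ //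
      IsStandard flatRank (fun F => flatRank F + 1) Set.univ m ∧ m.degree = d} := by
  have : Finite (Flat M) := Subtype.finite
  have := Fintype.ofFinite (Flat M)
  obtain ⟨hbot, hy, hK⟩ := isChowIdeal_ker hM (Ideal.Quotient.mkₐ ℚ (augChowIdeal M))
    fun p hp => Ideal.Quotient.eq_zero_iff_mem.2 hp
  refine finrank_map_homogeneousSubmodule flatRank_strictMono flatRank_sup_add_le isBound_succ
    (Ideal.Quotient.mkₐ ℚ (augChowIdeal M)) (avoidingSum M) avoidingSum_isHomogeneous hy ?_ ?_ d
  · rintro p (h | ⟨h1, h2⟩ | h | h)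
    · exact absurd trivial h
    · exact hK.incomp _ _ h1 h2
    · exact hK.pair_mem flatRank_strictMono _ _ h
    · exact hK.pow_succ_mem hbot _
  · intro p hp
    exact augChowIdeal_le_comap hM (by simp [flatRank_bot]) (Ideal.Quotient.eq_zero_iff_mem.1 hp)

-- Phrased through the kernel of one map `q`, so that the iterated quotient `ChowRing` can be
-- treated as a single quotient of the polynomial ring.
omit [Fintype (Flat M)] in
theorem finrank_map_of_ker_eq {A : Type*} [CommRing A] [Algebra ℚ A] (hM : M.E = Set.univ)
    (hl : M.Loopless) (q : PolyRing M →ₐ[ℚ] A)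
    (hq : ∀ p, q p = 0 ↔ p ∈ Ideal.span (Set.range (y M)) ⊔ augChowIdeal M) (d : ℕ) :
    Module.finrank ℚ ((homogeneousSubmodule (Flat M ⊕ E) ℚ d).map q.toLinearMap) =
      Nat.card {m : Flat M →₀ ℕ //
        IsStandard flatRank (fun F => max 1 (flatRank F)) Set.univ m ∧ m.degree = d} := by
  have : Finite (Flat M) := Subtype.finite
  have := Fintype.ofFinite (Flat M)
  obtain ⟨hbot, hy, hK⟩ := isChowIdeal_ker hM q fun p hp => (hq p).2 (Ideal.mem_sup_right hp)
  have hqy : ∀ e, q (y M e) = 0 := fun e =>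
    (hq _).2 (Ideal.mem_sup_left (Ideal.subset_span ⟨e, rfl⟩))
  have hnl : ∀ e, M.IsNonloop e := fun e => Matroid.isNonloop_of_loopless (hM ▸ Set.mem_univ e)
  refine finrank_map_homogeneousSubmodule flatRank_strictMono flatRank_sup_add_le isBound_max
    q (avoidingSum M) avoidingSum_isHomogeneous hy ?_ ?_ d
  · rintro p (h | ⟨h1, h2⟩ | h | h)
    · exact absurd trivial h
    · exact hK.incomp _ _ h1 h2
    · exact hK.pair_mem flatRank_strictMono _ _ h
    · refine hK.pow_max_mem hbot ?_ _
      rintro _ ⟨e, -, rfl⟩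
      have h1 : q (rename Sum.inl (upperSum ℚ (⊥ : Flat M))) = 0 := hbot
      have h2 := hy e
      rw [hqy, avoidingSum_eq hM, map_sub, map_sub, h1, zero_sub, eq_comm, neg_eq_zero] at h2
      exact h2
  · set I := relatorIdeal ℚ (flatRank : Flat M → ℕ) (fun F => max 1 (flatRank F)) Set.univ
      with hI
    have hpow : ∀ F : Flat M, flatRank F ≤ 1 → upperSum ℚ F ∈ I := fun F hF => by
      have : upperSum ℚ F ^ max 1 (flatRank F) ∈ I := Ideal.subset_span (.pow (Set.mem_univ F))
      rwa [max_eq_left hF, pow_one] at this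
    have hle : Ideal.span (Set.range (y M)) ⊔ augChowIdeal M ≤ I.comap (eliminate M) := by
      refine sup_le ?_ (augChowIdeal_le_comap hM (by simp [flatRank_bot]))
      rw [Ideal.span_le]
      rintro _ ⟨e, rfl⟩
      have : eliminate M (y M e) = avoidingSum M e := by simp [eliminate, y]
      change eliminate M (y M e) ∈ I
      rw [this, avoidingSum_eq hM]
      exact I.sub_mem (hpow _ (by simp [flatRank_bot])) (hpow _ (flatRank_pointFlat (hnl e)).le)
    exact fun p hp => hle ((hq p).1 hp)

omit [Finite E] [Fintype (Flat M)] in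
theorem mk_mk_eq_zero_iff (hl : M.Loopless) (p : PolyRing M) :
    Ideal.Quotient.mk (chowIdeal M) (Ideal.Quotient.mk (augChowIdeal M) p) = 0 ↔
      p ∈ Ideal.span (Set.range (y M)) ⊔ augChowIdeal M := by
  rw [Ideal.Quotient.eq_zero_iff_mem, chowIdeal, if_pos hl, ← Ideal.mem_quotient_iff_mem_sup,
    Ideal.map_span, ← Set.range_comp]
  rfl

omit [Fintype (Flat M)] in
theorem finrank_chowRingPiece (hM : M.E = Set.univ) (hl : M.Loopless) (d : ℕ) :
    Module.finrank ℚ (chowRingPiece M d) = Nat.card {m : Flat M →₀ ℕ //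
      IsStandard flatRank (fun F => max 1 (flatRank F)) Set.univ m ∧ m.degree = d} := by
  rw [← finrank_map_of_ker_eq (A := ChowRing M) hM hl ((Ideal.Quotient.mkₐ ℚ (chowIdeal M)).comp
    (Ideal.Quotient.mkₐ ℚ (augChowIdeal M))) (mk_mk_eq_zero_iff hl) d, chowRingPiece,
    augChowRingPiece, ← Submodule.map_comp]
  rfl

end ChowRings

/-! ### Weak maps: bases, independence and rank -/

section WeakMaps

variable {E E' : Type*} {M : Matroid E} {M' : Matroid E'} {φ : E ≃ E'}

theorem isBase_of_indicator_mem_basePolytope [Finite E] {S : Set E}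
    (hS : S.indicator 1 ∈ basePolytope M) : M.IsBase S := by
  classical
  have := Fintype.ofFinite E
  by_contra hnot
  -- Coefficients `1` on `S` and `-1` off it: among indicator vectors, `S` is the unique maximizer.
  -- If `S` is not a base, `f` separates it strictly from all bases and so from their hull.
  set f : (E → ℝ) → ℝ := fun p => ∑ e, (2 * S.indicator 1 e - 1) * p e with hf
  have hlin : IsLinearMap ℝ f := by
    refine ⟨fun p q => ?_, fun c p => ?_⟩
    · simp only [hf, Pi.add_apply, mul_add, Finset.sum_add_distrib]
    · simp only [hf, Pi.smul_apply, smul_eq_mul, Finset.mul_sum]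
      exact Finset.sum_congr rfl fun e _ => by ring
  have hsub : basePolytope M ⊆ {p | f p < f (S.indicator 1)} := by
    refine convexHull_min ?_ (convex_halfSpace_lt hlin _)
    rintro _ ⟨B, hB, rfl⟩
    have hne : B ≠ S := by rintro rfl; exact hnot hB
    have hle : ∀ e, (2 * S.indicator (1 : E → ℝ) e - 1) * B.indicator 1 e ≤
        (2 * S.indicator (1 : E → ℝ) e - 1) * S.indicator 1 e := by
      intro e
      by_cases h1 : e ∈ S <;> by_cases h2 : e ∈ B <;> simp [h1, h2]
    obtain ⟨e, he⟩ : ∃ e, ¬ (e ∈ B ↔ e ∈ S) := by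
      by_contra! h
      exact hne (Set.ext h)
    refine Finset.sum_lt_sum (fun e _ => hle e) ⟨e, Finset.mem_univ e, ?_⟩
    by_cases h1 : e ∈ S <;> by_cases h2 : e ∈ B <;> simp_all
  exact lt_irrefl (f (S.indicator 1)) (hsub hS)

theorem IsWeakMap.isBase_preimage [Finite E] (hφ : IsWeakMap φ M M') {B : Set E'}
    (hB : M'.IsBase B) : M.IsBase (φ ⁻¹' B) := by
  obtain ⟨p, hp, hpB⟩ := hφ (subset_convexHull ℝ _ ⟨B, hB, rfl⟩)
  have : p = (φ ⁻¹' B).indicator 1 := by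
    ext e
    have := congrFun hpB (φ e)
    simp only [LinearEquiv.funCongrLeft_apply, LinearMap.funLeft_apply, Equiv.symm_apply_apply]
      at this
    rw [this]
    rfl
  exact isBase_of_indicator_mem_basePolytope (this ▸ hp)

theorem IsWeakMap.indep_preimage [Finite E] (hφ : IsWeakMap φ M M') {I : Set E'}
    (hI : M'.Indep I) : M.Indep (φ ⁻¹' I) := by
  obtain ⟨B, hB, hIB⟩ := hI.exists_isBase_superset
  exact (hφ.isBase_preimage hB).indep.subset (Set.preimage_mono hIB)

theorem encard_preimage_equiv (φ : E ≃ E') (S : Set E') : (φ ⁻¹' S).encard = S.encard := by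
  rw [← Equiv.image_symm_eq_preimage, φ.symm.injective.encard_image]

theorem IsWeakMap.eRk_image_le [Finite E] (hφ : IsWeakMap φ M M') (S : Set E) :
    M'.eRk (φ '' S) ≤ M.eRk S := by
  rw [Matroid.eRk_le_iff]
  intro I hIS hI
  rw [← encard_preimage_equiv φ]
  refine (hφ.indep_preimage hI).encard_le_eRk_of_subset ?_
  intro e he
  obtain ⟨e', he', h⟩ := hIS he
  rwa [← φ.injective h]

theorem IsWeakMap.loopless [Finite E] (hφ : IsWeakMap φ M M')
    (hM' : M'.E = Set.univ) (h : M'.Loopless) : M.Loopless := by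
  rw [Matroid.loopless_iff_forall_isNonloop]
  intro e _
  rw [← Matroid.indep_singleton]
  have h1 : M'.Indep {φ e} :=
    Matroid.indep_singleton.2 (Matroid.isNonloop_of_loopless (hM' ▸ Set.mem_univ _))
  convert hφ.indep_preimage h1
  ext e'
  simp

/-! ### Lifting chains of flats along a weak map -/

/-- A chain of sets admits an independent set containing a basis of each of its members. -/
theorem exists_indep_isBasis_inter (M : Matroid E) (hM : M.E = Set.univ) (C : Finset (Set E))
    (hC : ∀ F ∈ C, ∀ G ∈ C, F ⊆ G ∨ G ⊆ F) :
    ∃ I, M.Indep I ∧ ∀ F ∈ C, M.IsBasis (I ∩ F) F := by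
  classical
  induction hn : C.card using Nat.strong_induction_on generalizing C with
  | _ n ih =>
  rcases C.eq_empty_or_nonempty with rfl | hne
  · exact ⟨∅, M.empty_indep, by simp⟩
  obtain ⟨F, hF, hmax⟩ := C.exists_maximal hne
  have hle : ∀ G ∈ C, G ⊆ F := fun G hG => by
    rcases hC G hG F hF with h | h
    exacts [h, hmax hG h]
  obtain ⟨I, hI, hIC⟩ := ih (C.erase F).card (hn ▸ Finset.card_erase_lt_of_mem hF) (C.erase F)
    (fun G hG H hH => hC G (Finset.mem_of_mem_erase hG) H (Finset.mem_of_mem_erase hH)) rfl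
  obtain ⟨J, hJ, hIJ⟩ := (hI.subset (Set.inter_subset_left (t := F))).subset_isBasis_of_subset
    Set.inter_subset_right (hM ▸ Set.subset_univ F)
  refine ⟨J, hJ.indep, fun G hG => ?_⟩
  by_cases hGF : G = F
  · subst hGF
    rwa [Set.inter_eq_self_of_subset_left hJ.subset]
  · have hb := hIC G (Finset.mem_erase.2 ⟨hGF, hG⟩)
    have hsub : I ∩ G ⊆ J ∩ G := fun e he =>
      ⟨hIJ ⟨he.1, hle G hG he.2⟩, he.2⟩
    -- Enlarging `I` to `J` adds nothing inside a smaller member `G`, because `I ∩ G` is already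
    -- maximal independent there.
    rwa [← hb.eq_of_subset_indep (hJ.indep.subset Set.inter_subset_left) hsub
      Set.inter_subset_right]

theorem IsWeakMap.eRk_closure_preimage [Finite E] (hφ : IsWeakMap φ M M') {I F : Set E'}
    (hI : M'.IsBasis I F) : M.eRk (M.closure (φ ⁻¹' I)) = M'.eRk F := by
  rw [Matroid.eRk_closure_eq, (hφ.indep_preimage hI.indep).eRk_eq_encard,
    encard_preimage_equiv, hI.encard_eq_eRk]

theorem subset_image_closure_preimage (hM : M.E = Set.univ) (I : Set E') :
    I ⊆ φ '' M.closure (φ ⁻¹' I) := by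
  intro e he
  exact ⟨φ.symm e, M.mem_closure_of_mem' (by simpa using he) (hM ▸ Set.mem_univ _), by simp⟩

/-- The rank cannot rise along `φ`, and cannot fall below that of `F` because the image still
contains `I`, a basis of `F`. -/
theorem IsWeakMap.eRk_image_closure_preimage [Finite E] (hφ : IsWeakMap φ M M')
    (hM : M.E = Set.univ) {I F : Set E'} (hI : M'.IsBasis I F) :
    M'.eRk (φ '' M.closure (φ ⁻¹' I)) = M'.eRk F := by
  refine le_antisymm ((hφ.eRk_image_le _).trans (hφ.eRk_closure_preimage hI).le) ?_
  rw [← hI.eRk_eq_eRk]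
  exact M'.eRk_mono (subset_image_closure_preimage hM I)

theorem IsWeakMap.closure_image_closure_preimage [Finite E] [Finite E'] (hφ : IsWeakMap φ M M')
    (hM : M.E = Set.univ) {I F : Set E'} (hI : M'.IsBasis I F) (hF : M'.IsFlat F) :
    M'.closure (φ '' M.closure (φ ⁻¹' I)) = F := by
  have hfin : M'.IsRkFinite I := Matroid.eRk_ne_top_iff.1 (eRk_ne_top_of_finite M' _)
  rw [← hfin.closure_eq_closure_of_subset_of_eRk_ge_eRk
    (subset_image_closure_preimage (φ := φ) (M := M) hM I)
    (by rw [hφ.eRk_image_closure_preimage hM hI, hI.eRk_eq_eRk]),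
    hI.closure_eq_closure, hF.closure]

theorem IsWeakMap.whitneyMap_surjective [Finite E] [Finite E'] (hφ : IsWeakMap φ M M')
    (hM : M.E = Set.univ) (hM' : M'.E = Set.univ) {r : ℕ} (k : Fin r → ℕ) :
    Function.Surjective (whitneyMap φ M M' k) := by
  classical
  have key : ∀ F' : Flag M' k, ∃ F : Flag M k,
      whitneyMap φ M M' k (Finsupp.single F 1) = Finsupp.single F' 1 := by
    intro F'
    obtain ⟨I, -, hI⟩ := exists_indep_isBasis_inter M' hM' (Finset.univ.image F'.1) (by
      simp only [Finset.mem_image, Finset.mem_univ, true_and]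
      rintro _ ⟨i, rfl⟩ _ ⟨j, rfl⟩
      exact (le_total i j).imp (fun h => F'.2.2 h) fun h => F'.2.2 h)
    have hI' : ∀ i, M'.IsBasis (I ∩ F'.1 i) (F'.1 i) := fun i =>
      hI _ (Finset.mem_image_of_mem _ (Finset.mem_univ i))
    obtain ⟨F, hF⟩ : ∃ F : Flag M k, ∀ i, F.1 i = M.closure (φ ⁻¹' (I ∩ F'.1 i)) :=
      ⟨⟨fun i => M.closure (φ ⁻¹' (I ∩ F'.1 i)), fun i => ⟨M.isFlat_closure _, by
          rw [hφ.eRk_closure_preimage (hI' i), (F'.2.1 i).2]⟩,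
        fun i j hij => M.closure_subset_closure (Set.preimage_mono
          (Set.inter_subset_inter_right _ (F'.2.2 hij)))⟩, fun _ => rfl⟩
    have hrank : ∀ i, M'.eRk (φ '' F.1 i) = (k i : ℕ∞) := fun i => by
      rw [hF, hφ.eRk_image_closure_preimage hM (hI' i), (F'.2.1 i).2]
    have hpush : F.push φ M' hrank = F' := Subtype.ext (funext fun i => by
      change M'.closure (φ '' F.1 i) = _
      rw [hF, hφ.closure_image_closure_preimage hM (hI' i) (F'.2.1 i).1])
    refine ⟨F, ?_⟩
    rw [whitneyMap, Finsupp.linearCombination_single, one_smul, dif_pos hrank, hpush]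
  intro v
  induction v using Finsupp.induction_linear with
  | zero => exact ⟨0, map_zero _⟩
  | add v w hv hw =>
    obtain ⟨a, rfl⟩ := hv
    obtain ⟨b, rfl⟩ := hw
    exact ⟨a + b, map_add _ _ _⟩
  | single F' c =>
    obtain ⟨F, hF⟩ := key F'
    refine ⟨c • Finsupp.single F 1, ?_⟩
    rw [map_smul, hF, Finsupp.smul_single, smul_eq_mul, mul_one]

/-- The flat of `M'` spanned by the image of a flat of `M`. -/
def pushFlat (φ : E ≃ E') (M' : Matroid E') (F : Flat M) : Flat M' :=
  ⟨M'.closure (φ '' F.1), M'.isFlat_closure _⟩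

/-- Every standard exponent of `M'` lifts to a standard exponent of `M`. -/
theorem IsWeakMap.exists_isStandard_mapDomain_eq [Finite E] [Finite E'] (hφ : IsWeakMap φ M M')
    (hM : M.E = Set.univ) (hM' : M'.E = Set.univ) (β : ℕ → ℕ) (m' : Flat M' →₀ ℕ)
    (hm' : IsStandard flatRank (fun F => β (flatRank F)) Set.univ m') :
    ∃ m : Flat M →₀ ℕ, IsStandard flatRank (fun F => β (flatRank F)) Set.univ m ∧
      m.degree = m'.degree ∧ m.mapDomain (pushFlat φ M') = m' := by
  classical
  obtain ⟨I, -, hI⟩ := exists_indep_isBasis_inter M' hM' (m'.support.image Subtype.val) (by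
    simp only [Finset.mem_image, Finsupp.mem_support_iff]
    rintro _ ⟨F, hF, rfl⟩ _ ⟨G, hG, rfl⟩
    exact hm'.chain F G hF hG)
  have hI' : ∀ F ∈ m'.support, M'.IsBasis (I ∩ F.1) F.1 := fun F hF =>
    hI _ (Finset.mem_image_of_mem _ hF)
  -- The lift depends on `m'` through `I` and is well behaved only on the support of `m'`, which is
  -- all that is needed.
  set lift : Flat M' → Flat M :=
    fun F => ⟨M.closure (φ ⁻¹' (I ∩ F.1)), M.isFlat_closure _⟩ with hlift
  have hpush : ∀ F ∈ m'.support, pushFlat φ M' (lift F) = F := fun F hF =>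
    Subtype.ext (hφ.closure_image_closure_preimage hM (hI' F hF) F.2)
  have hrank : ∀ F ∈ m'.support, flatRank (lift F) = flatRank F := fun F hF => by
    rw [flatRank, flatRank, hφ.eRk_closure_preimage (hI' F hF)]
  have hmono : ∀ F G : Flat M', F ≤ G → lift F ≤ lift G := fun F G h =>
    M.closure_subset_closure (Set.preimage_mono (Set.inter_subset_inter_right _ h))
  have hinj : Set.InjOn lift m'.support := fun F hF G hG h => by
    rw [← hpush F hF, h, hpush G hG]
  have happ : ∀ F ∈ m'.support, m'.mapDomain lift (lift F) = m' F := fun F hF =>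
    Finsupp.mapDomain_apply' _ m' (Set.Subset.refl _) hinj hF
  have hex : ∀ H, m'.mapDomain lift H ≠ 0 → ∃ F ∈ m'.support, lift F = H := fun H hH => by
    have := Finsupp.mapDomain_support (Finsupp.mem_support_iff.2 hH)
    simpa using this
  refine ⟨m'.mapDomain lift, ⟨fun _ _ => trivial, ?_, ?_, ?_⟩, ?_, ?_⟩
  · intro G H hG hH
    obtain ⟨G, hG', rfl⟩ := hex G hG
    obtain ⟨H, hH', rfl⟩ := hex H hH
    rw [Finsupp.mem_support_iff] at hG' hH'
    exact (hm'.chain G H hG' hH').imp (hmono _ _) (hmono _ _)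
  · intro H hH
    obtain ⟨H, hH', rfl⟩ := hex H hH
    rw [happ H hH', hrank H hH']
    exact hm'.lt H (Finsupp.mem_support_iff.1 hH')
  · intro G H hGH hG hH
    obtain ⟨G, hG', rfl⟩ := hex G hG
    obtain ⟨H, hH', rfl⟩ := hex H hH
    rw [happ H hH', hrank H hH', hrank G hG']
    have hG0 := Finsupp.mem_support_iff.1 hG'
    have hH0 := Finsupp.mem_support_iff.1 hH'
    refine hm'.lt_sub G H ?_ hG0 hH0
    rcases hm'.chain G H hG0 hH0 with h | h
    · exact lt_of_le_of_ne h (by rintro rfl; exact hGH.ne rfl)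
    · exact absurd (hmono _ _ h) hGH.not_ge
  · rw [Finsupp.degree_mapDomain]
  · rw [← Finsupp.mapDomain_comp]
    conv_rhs => rw [← Finsupp.mapDomain_id (v := m')]
    exact Finsupp.mapDomain_congr hpush

/-! ### Counting standard exponents -/

theorem finite_isStandard {L : Type*} [SemilatticeSup L] [Finite L] (r b : L → ℕ) (d : ℕ) :
    Finite {m : L →₀ ℕ // IsStandard r b Set.univ m ∧ m.degree = d} :=
  ((Finsupp.finite_of_degree_le d).subset fun _ hm => hm.2.le).to_subtype

/-- Lifting exponents is injective although each lift involves a choice: pushing forward along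
`pushFlat` recovers the original. Letting the bound be any function `β` of the rank serves both
rings at once. -/
theorem IsWeakMap.card_isStandard_le [Finite E] [Finite E'] (hφ : IsWeakMap φ M M')
    (hM : M.E = Set.univ) (hM' : M'.E = Set.univ) (β : ℕ → ℕ) (d : ℕ) :
    Nat.card {m : Flat M' →₀ ℕ //
      IsStandard flatRank (fun F => β (flatRank F)) Set.univ m ∧ m.degree = d} ≤
    Nat.card {m : Flat M →₀ ℕ //
      IsStandard flatRank (fun F => β (flatRank F)) Set.univ m ∧ m.degree = d} := by
  have := finite_isStandard (L := Flat M) flatRank (fun F => β (flatRank F)) d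
  choose f hf using fun m : {m : Flat M' →₀ ℕ //
      IsStandard flatRank (fun F => β (flatRank F)) Set.univ m ∧ m.degree = d} =>
    hφ.exists_isStandard_mapDomain_eq hM hM' β m.1 m.2.1
  refine Nat.card_le_card_of_injective
    (fun m => ⟨f m, (hf m).1, (hf m).2.1.trans m.2.2⟩) fun m n hmn => ?_
  refine Subtype.ext ?_
  rw [← (hf m).2.2, ← (hf n).2.2, show f m = f n from congrArg Subtype.val hmn]

theorem card_isStandard_eq_zero {L : Type*} [SemilatticeSup L] [Fintype L] {r b : L → ℕ} {d : ℕ}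
    (hd : ∑ F, b F < d) :
    Nat.card {m : L →₀ ℕ // IsStandard r b Set.univ m ∧ m.degree = d} = 0 := by
  refine Nat.card_eq_zero.2 (Or.inl ⟨fun ⟨m, hm, hmd⟩ => ?_⟩)
  have : m.degree ≤ ∑ F, b F := by
    rw [Finsupp.degree_eq_sum]
    refine Finset.sum_le_sum fun F _ => ?_
    by_cases h : m F = 0
    · omega
    · exact (hm.lt F h).le
  omega

theorem exists_polynomial_of_finrank_le {s s' : ℕ → ℕ} {N : ℕ} (hs : ∀ d, N < d → s d = 0)
    (hle : ∀ d, s' d ≤ s d) :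
    ∃ P P' : Polynomial ℤ, (P : PowerSeries ℤ) = PowerSeries.mk (fun d => (s d : ℤ)) ∧
      (P' : PowerSeries ℤ) = PowerSeries.mk (fun d => (s' d : ℤ)) ∧
      ∀ i, 0 ≤ (P - P').coeff i := by
  have key : ∀ t : ℕ → ℕ, (∀ d, t d ≤ s d) → ∀ d,
      (PowerSeries.trunc (N + 1) (PowerSeries.mk fun d => (t d : ℤ))).coeff d = t d := by
    intro t ht d
    rw [PowerSeries.coeff_trunc, PowerSeries.coeff_mk]
    split_ifs with h
    · rfl
    · have h1 := hs d (by omega)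
      have h2 := ht d
      rw [show t d = 0 by omega]
      rfl
  refine ⟨PowerSeries.trunc (N + 1) (PowerSeries.mk fun d => (s d : ℤ)),
    PowerSeries.trunc (N + 1) (PowerSeries.mk fun d => (s' d : ℤ)), ?_, ?_, fun i => ?_⟩
  · ext d
    rw [Polynomial.coeff_coe, key s (fun _ => le_rfl), PowerSeries.coeff_mk]
  · ext d
    rw [Polynomial.coeff_coe, key s' hle, PowerSeries.coeff_mk]
  · rw [Polynomial.coeff_sub, key s (fun _ => le_rfl), key s' hle]
    have := hle i
    omega

end WeakMaps

end MatroidChow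

theorem corollary8p16 {E : Type*} {E' : Type*} [Finite E] [Finite E']
    (M : Matroid E) (M' : Matroid E') (hM : M.E = Set.univ) (hM' : M'.E = Set.univ)
    (φ : E ≃ E') (hφ : MatroidChow.IsWeakMap φ M M') :
    (∀ d : ℕ, Function.Surjective (MatroidChow.chowMap φ M M' d)) ∧
    (∀ d : ℕ, Function.Surjective (MatroidChow.augChowMap φ M M' d)) ∧
    (∃ P P' : Polynomial ℤ,
      (P : PowerSeries ℤ) = MatroidChow.chowSeries M ∧
      (P' : PowerSeries ℤ) = MatroidChow.chowSeries M' ∧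
      ∀ i : ℕ, 0 ≤ (P - P').coeff i) ∧
    (∃ P P' : Polynomial ℤ,
      (P : PowerSeries ℤ) = MatroidChow.augChowSeries M ∧
      (P' : PowerSeries ℤ) = MatroidChow.augChowSeries M' ∧
      ∀ i : ℕ, 0 ≤ (P - P').coeff i) := by
  classical
  have : Finite (MatroidChow.Flat M) := Subtype.finite
  have := Fintype.ofFinite (MatroidChow.Flat M)
  refine ⟨fun d t => ?_, fun d => ?_, ?_, ?_⟩
  · by_cases hl' : M'.Loopless
    · have hl := hφ.loopless hM' hl'
      have hsurj : Function.Surjective (MatroidChow.chowSumMap φ M M' d) :=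
        (DirectSum.lmap_surjective _).2 fun k =>
          LinearMap.rTensor_surjective _ (hφ.whitneyMap_surjective hM hM' _)
      obtain ⟨s, hs⟩ := hsurj (t ⟨hl'⟩)
      refine ⟨fun _ => s, funext fun h => ?_⟩
      simpa [MatroidChow.chowMap, hl] using hs
    · exact ⟨0, funext fun h => absurd h.down hl'⟩
  · exact (DirectSum.lmap_surjective _).2 fun k =>
      LinearMap.rTensor_surjective _ (hφ.whitneyMap_surjective hM hM' _)
  -- Any crude degree bound will do for `N`: each exponent of a standard monomial is at most its
  -- bound.
  · refine MatroidChow.exists_polynomial_of_finrank_le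
      (N := ∑ F : MatroidChow.Flat M, max 1 (MatroidChow.flatRank F)) (fun d hd => ?_) fun d => ?_
    · by_cases hl : M.Loopless
      · rw [MatroidChow.finrank_chowRingPiece hM hl]
        exact MatroidChow.card_isStandard_eq_zero hd
      · exact MatroidChow.finrank_chowRingPiece_of_not_loopless hl d
    · by_cases hl' : M'.Loopless
      · rw [MatroidChow.finrank_chowRingPiece hM' hl',
          MatroidChow.finrank_chowRingPiece hM (hφ.loopless hM' hl')]
        exact hφ.card_isStandard_le hM hM' (fun n => max 1 n) d
      · rw [MatroidChow.finrank_chowRingPiece_of_not_loopless hl' d]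
        exact Nat.zero_le _
  · refine MatroidChow.exists_polynomial_of_finrank_le
      (N := ∑ F : MatroidChow.Flat M, (MatroidChow.flatRank F + 1)) (fun d hd => ?_) fun d => ?_
    · rw [MatroidChow.finrank_augChowRingPiece hM]
      exact MatroidChow.card_isStandard_eq_zero hd
    · rw [MatroidChow.finrank_augChowRingPiece hM', MatroidChow.finrank_augChowRingPiece hM]
      exact hφ.card_isStandard_le hM hM' (fun n => n + 1) d
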